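/- Let $P,Q$ be probability distributions on a measurable space $\mathcal X$, with densities $p,q$ with respect to a common dominating measure $\mu$ (for instance $\mu=P+Q$), and let $\varepsilon>0$. **Tests.** A randomized test $K$ outputs ``$P$'' or ``$Q$'' on every finite sample, with output probabilities that depend measurably on the sample. It is $\varepsilon$-DP if $\Pr[K(x)=o]\le e^{\varepsilon}\Pr[K(x')=o]$ for both outputs $o$ and all data sets $x,x'$ of equal size that differ in at most one entry. Let $\mathrm{adv}_n(K)=\Pr_{x\sim P^n}[K(x)=P]-\Pr_{x\sim Q^n}[K(x)=P]$. For $0<\gamma<1$ let $SC_\gamma(K)$ be the least $N\in\mathbb N$ such that $\mathrm{adv}_n(K)\ge\gamma$ for all $n\ge N$ ($\infty$ if there is none), and let $SC_{\gamma,\varepsilon}$ be the minimum of $SC_\gamma(K)$ over all $\varepsilon$-DP tests $K$. **Clamping.** Let $D_y(p\|q)=\int\max(p-e^{y}q,0)\,d\mu$ and $\tau=\max\{D_\varepsilon(p\|q),D_\varepsilon(q\|p)\}$. Let $b$ be the largest $y\in[0,\varepsilon]$ with $D_y(p\|q)=\tau$, let $\varepsilon_-$ be the largest $y\in[0,\varepsilon]$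 with $D_y(q\|p)=\tau$, and put $a=-\varepsilon_-$. (If $\tau=D_\varepsilon(p\|q)$, which holds after interchanging $P$ and $Q$ if necessary, then $b=\varepsilon$, and with $\varepsilon'=\varepsilon_-$ the interval $[a,b]$ is $[-\varepsilon',\varepsilon]$.) Let $P',Q'$ have densities $p'=\min(e^{b}q,p)/(1-\tau)$ and $q'=\min(e^{-a}p,q)/(1-\tau)$ (if $\tau=1$, the term $(1-\tau)H^2(P',Q')$ below is read as $0$). Let $H^2(P',Q')=\frac12\int(\sqrt{p'}-\sqrt{q'})^2\,d\mu$ and $$R=\min\{\varepsilon,1\}\,\tau+(1-\tau)H^2(P',Q').$$ **Tests based on the clamped log-likelihood ratio.** Let $\mathrm{cLLR}(x)=\sum_i\max\bigl(a,\min(\log\frac{p(x_i)}{q(x_i)},b)\bigr)$. For $\kappa\in\mathbb R$, the soft test $\mathrm{scLLR}^{\kappa}$ outputs $P$ with probability proportional to $e^{(\mathrm{cLLR}(x)-\kappa)/2}$ and $Q$ with probability proportional to $1$. The noisy test $\mathrm{ncLLR}^{\kappa}_s$ outputs $P$ if and only if $\mathrm{cLLR}(x)+Z>\kappa$, where $Z$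 has the centered Laplace distribution of scale $s$. **Theorem.** For every $\gamma\in(0,1)$ there are constants $0<c_\gamma\le C_\gamma<\infty$ such that, for all $\mathcal X,P,Q$ and $\varepsilon>0$ as above: 1. $c_\gamma/R\le SC_{\gamma,\varepsilon}\le C_\gamma/R$. 2. $c_\gamma/R\le 1/\mathrm{adv}_1(\mathrm{scLLR}^{0})\le C_\gamma/R$. 3. There is a threshold $\kappa\in\mathbb R$, which does not depend on the sample size and equals $0$ if $\gamma<\frac12$, such that $\mathrm{scLLR}^{\kappa}$ and, for every $s\in[(b-a)/\varepsilon,\,2]$, also $\mathrm{ncLLR}^{\kappa}_s$ are $\varepsilon$-DP and have $SC_\gamma$ between $c_\gamma/R$ and $C_\gamma/R$. Here $1/0=\infty$ (all quantities are $\infty$ if $P=Q$). In particular, all of $SC_{\gamma,\varepsilon}$, $SC_\gamma$ of the two tests, and $1/\mathrm{adv}_1(\mathrm{scLLR}^0)$ are $\Theta(1/R)$, and for $\varepsilon\le1$ one has $R=\varepsilon\tau+(1-\tau)H^2(P',Q')$. -/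

import Mathlib

open MeasureTheory Set
open scoped NNReal ENNReal

noncomputable section

namespace PrivTest

/-! ### Tests, advantage, privacy, sample complexity -/

/-- A randomized test with the two outputs `P` and `Q`, on samples of every size: `K n x` is the
probability that the test outputs `P` on the data set `x` of size `n`. -/
abbrev RandTest (X : Type*) := (n : ℕ) → (Fin n → X) → ℝ

/-- The output probabilities are measurable functions of the data with values in `[0, 1]`. -/
def IsTest {X : Type*} [MeasurableSpace X] (K : RandTest X) : Prop :=
  ∀ n, Measurable (K n) ∧ ∀ x, K n x ∈ Icc (0 : ℝ) 1

/-- Two data sets of the same size are neighbors if they differ in at most one entry. -/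
def Neighbors {X : Type*} {n : ℕ} (x x' : Fin n → X) : Prop :=
  ∃ i, ∀ j, j ≠ i → x j = x' j

/-- Pure `ε`-differential privacy of a test with two outputs. -/
def IsDP {X : Type*} (ε : ℝ) (K : RandTest X) : Prop :=
  ∀ (n : ℕ) (x x' : Fin n → X), Neighbors x x' →
    K n x ≤ Real.exp ε * K n x' ∧ 1 - K n x ≤ Real.exp ε * (1 - K n x')

/-- The advantage of `K` on `n` i.i.d. samples:
the probability of output `P` under `P ^ n` minus the probability of output `P` under `Q ^ n`. -/
def adv {X : Type*} [MeasurableSpace X] (P Q : Measure X) (K : RandTest X) (n : ℕ) : ℝ :=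
  (∫ x, K n x ∂(Measure.pi fun _ : Fin n => P)) - ∫ x, K n x ∂(Measure.pi fun _ : Fin n => Q)

/-- The sample complexity of the test `K` at advantage level `γ`: the least `N` such that the
advantage is at least `γ` for every `n ≥ N` (`∞` if there is none). -/
def SC {X : Type*} [MeasurableSpace X] (γ : ℝ) (P Q : Measure X) (K : RandTest X) : ℝ≥0∞ :=
  ⨅ (N : ℕ) (_ : ∀ n, N ≤ n → γ ≤ adv P Q K n), (N : ℝ≥0∞)

/-- The sample complexity of `ε`-differentially privately distinguishing `P` from `Q`. -/
def privSC {X : Type*} [MeasurableSpace X] (γ ε : ℝ) (P Q : Measure X) : ℝ≥0∞ :=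
  ⨅ (K : RandTest X) (_ : IsTest K) (_ : IsDP ε K), SC γ P Q K

/-! ### Clamped log-likelihood ratio tests

Here `p` and `q` are the densities of `P` and `Q`. -/

/-- The log-likelihood ratio of one sample, clamped to `[a, b]`: `max a (min (log (p x / q x)) b)`.
The logarithm is taken in `[-∞, ∞]`, so it is `∞` if `q x = 0 < p x`, and `-∞` if `p x = 0`. -/
def clampedLog {X : Type*} (p q : X → ℝ≥0) (a b : ℝ) (x : X) : ℝ :=
  (max (a : EReal) (min (ENNReal.log ((p x : ℝ≥0∞) / (q x : ℝ≥0∞))) (b : EReal))).toReal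

/-- The clamped log-likelihood ratio statistic. -/
def cLLR {X : Type*} (p q : X → ℝ≥0) (a b : ℝ) {n : ℕ} (x : Fin n → X) : ℝ :=
  ∑ i, clampedLog p q a b (x i)

/-- The soft clamped log-likelihood ratio test with offset `κ`: it outputs `P` with probability
proportional to `exp ((cLLR - κ) / 2)` and `Q` with probability proportional to `1`. -/
def scLLR {X : Type*} (p q : X → ℝ≥0) (a b κ : ℝ) : RandTest X := fun _ x =>
  Real.exp (1 / 2 * (cLLR p q a b x - κ)) / (Real.exp (1 / 2 * (cLLR p q a b x - κ)) + 1)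

/-- The centered Laplace distribution with scale `s > 0`. -/
def laplace (s : ℝ) : Measure ℝ :=
  volume.withDensity fun z => ENNReal.ofReal (Real.exp (-|z| / s) / (2 * s))

/-- The noisy clamped log-likelihood ratio test with Laplace noise of scale `s` and threshold `κ`:
it outputs `P` if `cLLR + Lap s > κ`, and `Q` otherwise. -/
def ncLLR {X : Type*} (p q : X → ℝ≥0) (a b s κ : ℝ) : RandTest X := fun _ x =>
  (laplace s).real {z | κ < cLLR p q a b x + z}

/-! ### The quantities in the rate -/

/-- The hockey-stick divergence `∫ max (p - exp y * q, 0)`. -/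
def hockeyStick {X : Type*} [MeasurableSpace X] (μ : Measure X) (p q : X → ℝ≥0) (y : ℝ) : ℝ :=
  ∫ x, max ((p x : ℝ) - Real.exp y * (q x : ℝ)) 0 ∂μ

/-- `τ`, the larger of the two hockey-stick divergences at `ε`. -/
def tau {X : Type*} [MeasurableSpace X] (μ : Measure X) (p q : X → ℝ≥0) (ε : ℝ) : ℝ :=
  max (hockeyStick μ p q ε) (hockeyStick μ q p ε)

/-- The largest `y ∈ [0, ε]` with `∫ max (p - exp y * q, 0) = τ`.

If `τ = ∫ max (p - exp ε * q, 0)` (which holds after interchanging `P` and `Q` if necessary), then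
`clampExp μ p q ε = ε`, and `clampExp μ q p ε` is the number usually written `ε'`.
Working with both keeps the definitions symmetric, so that no such assumption is needed. -/
def clampExp {X : Type*} [MeasurableSpace X] (μ : Measure X) (p q : X → ℝ≥0) (ε : ℝ) : ℝ :=
  sSup {y | y ∈ Icc 0 ε ∧ hockeyStick μ p q y = tau μ p q ε}

/-- The clamped and renormalized density
`p' = min (exp (clampExp μ p q ε) * q, p) / (1 - τ)`.
Since `tau` is symmetric, the density `q'` is `primeDensity μ q p ε`. -/
def primeDensity {X : Type*} [MeasurableSpace X] (μ : Measure X) (p q : X → ℝ≥0) (ε : ℝ)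
    (x : X) : ℝ :=
  min (Real.exp (clampExp μ p q ε) * (q x : ℝ)) (p x : ℝ) / (1 - tau μ p q ε)

/-- The squared Hellinger distance `1/2 * ∫ (√f - √g) ^ 2` of two densities. -/
def hellingerSq {X : Type*} [MeasurableSpace X] (μ : Measure X) (f g : X → ℝ) : ℝ :=
  1 / 2 * ∫ x, (Real.sqrt (f x) - Real.sqrt (g x)) ^ 2 ∂μ

/-- `min (ε, 1) * τ + (1 - τ) * H² (P', Q')`. -/
def rate {X : Type*} [MeasurableSpace X] (μ : Measure X) (p q : X → ℝ≥0) (ε : ℝ) : ℝ :=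
  min ε 1 * tau μ p q ε
    + (1 - tau μ p q ε) * hellingerSq μ (primeDensity μ p q ε) (primeDensity μ q p ε)

/-- `c * y ≤ x ≤ C * y`, in `[0, ∞]`. -/
def Within (c C : ℝ≥0) (x y : ℝ≥0∞) : Prop :=
  (c : ℝ≥0∞) * y ≤ x ∧ x ≤ (C : ℝ≥0∞) * y

end PrivTest

end

noncomputable section

namespace PrivTest

/-! ### Functions with values in the unit interval on product spaces -/

section Product

variable {X : Type*} [MeasurableSpace X]

/-! Clamping splits `p = pt + (p - pt)` and `q = qt + (q - qt)`. The clamped parts have equal mass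
`1 - τ` and satisfy `pt = exp L * qt` with `L` in `[a, b]`. The leftovers have mass `τ` each and sit
on `L = b` and on `L = a` respectively. With `h = (1 - τ) * H² (P', Q')` the affinity `∫ √(pt * qt)`
is `1 - τ - h`, and the rate is `R = min ε 1 * τ + h`. `ClampedSplit` records this structure, and
all estimates use only it.

No private test beats the rate: pass from `P ^ n` to `Q ^ n` through `W ^ n`, where `W` has density
`pt + (q - qt)`. From `P` to `W` only mass `τ` moves, and changing one entry changes the acceptance
probability of a private test by at most `min ε 1`; replacing the factors one by one costs at most
`n * min ε 1 * τ`. The affinity of `W` and `Q` is at least `1 - h`, so by tensorization the second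
passage costs at most `√(2 * n * h)`. Hence the advantage is at most `n * R + √(2 * n * R)`
(`ClampedSplit.adv_le_of_isDP`), which forces `n * R ≥ γ ^ 2 / 8`.

The threshold tests attain it by a Chernoff bound of order `1 / 2`. Since `exp (L / 2) * qt = √(pt *
qt)`, the moment of `exp (L / 2)` under `Q` is exactly `1 - h - (1 - exp (a / 2)) * τ`, and
symmetrically under `P` with `b`. One endpoint lies at distance exactly `ε` from zero, and the error
on that side decays like `exp (-n * R / 3)`. The other endpoint may be zero, so the error there is
controlled by the threshold instead: it is at most `1 / 2` at threshold zero, and as small as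
desired at a fixed threshold of suitable sign (`ClampedSplit.half_sub_le_adv`,
`ClampedSplit.one_sub_le_adv`). Both tests share the bounds collected in `IsSoftThreshold`.

For one sample the advantage of the soft test is computed exactly
(`ClampedSplit.integral_soft_sub`): the clamped parts contribute `h`, and the leftovers a multiple
of `τ` of order `min ε 1`. -/

lemma integrable_of_mem_Icc {Y : Type*} [MeasurableSpace Y] {ν : Measure Y} [IsFiniteMeasure ν]
    {f : Y → ℝ} (hf : Measurable f) (h : ∀ y, f y ∈ Icc (0 : ℝ) 1) : Integrable f ν :=
  Integrable.of_bound hf.aestronglyMeasurable 1 <| ae_of_all _ fun y => by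
    rw [Real.norm_eq_abs, abs_of_nonneg (h y).1]; exact (h y).2

lemma integral_mem_Icc {Y : Type*} [MeasurableSpace Y] {ν : Measure Y} [IsProbabilityMeasure ν]
    {f : Y → ℝ} (hf : Measurable f) (h : ∀ y, f y ∈ Icc (0 : ℝ) 1) :
    ∫ y, f y ∂ν ∈ Icc (0 : ℝ) 1 := by
  refine ⟨integral_nonneg fun y => (h y).1, ?_⟩
  calc ∫ y, f y ∂ν ≤ ∫ _, (1 : ℝ) ∂ν :=
        integral_mono (integrable_of_mem_Icc hf h) (integrable_const _) fun y => (h y).2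
    _ = 1 := by simp

lemma measurable_fin_cons (n : ℕ) :
    Measurable fun z : X × (Fin n → X) => (Fin.cons z.1 z.2 : Fin (n + 1) → X) := by
  refine measurable_pi_lambda _ fun i => ?_
  refine Fin.cases ?_ (fun j => ?_) i
  · simpa using measurable_fst
  · simp only [Fin.cons_succ]
    exact (measurable_pi_apply j).comp measurable_snd

lemma integral_pi_succ (P : Measure X) [IsProbabilityMeasure P] {n : ℕ}
    {f : (Fin (n + 1) → X) → ℝ} (hf : Measurable f) (h : ∀ x, f x ∈ Icc (0 : ℝ) 1) :
    ∫ x, f x ∂(Measure.pi fun _ : Fin (n + 1) => P) =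
      ∫ x₀, ∫ xs, f (Fin.cons x₀ xs) ∂(Measure.pi fun _ : Fin n => P) ∂P := by
  have hm := (measurePreserving_piFinSuccAbove (fun _ : Fin (n + 1) => P) 0).symm
  rw [← hm.integral_comp' f]
  have hfc : Measurable fun z : X × (Fin n → X) => f (Fin.cons z.1 z.2) :=
    hf.comp (measurable_fin_cons n)
  have heq : ∀ z : X × (Fin n → X),
      f ((MeasurableEquiv.piFinSuccAbove (fun _ : Fin (n + 1) => X) 0).symm z) =
        f (Fin.cons z.1 z.2) := fun z => by
    congr 1
    simp [MeasurableEquiv.piFinSuccAbove, Fin.insertNthEquiv]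
  simp_rw [heq]
  exact integral_prod _ (integrable_of_mem_Icc hfc fun z => h _)

lemma measurable_integral_right {Y Z : Type*} [MeasurableSpace Y] [MeasurableSpace Z]
    {ν : Measure Z} [SFinite ν] {f : Y × Z → ℝ} (hf : Measurable f) :
    Measurable fun y => ∫ z, f (y, z) ∂ν :=
  (StronglyMeasurable.integral_prod_right (f := fun y z => f (y, z))
    hf.stronglyMeasurable).measurable

/-- Replacing the factors of a power of `P` by `W` one at a time. -/
theorem integral_pi_sub_le_of_bounded_differences (P W : Measure X) [IsProbabilityMeasure P]
    [IsProbabilityMeasure W] {δ d : ℝ}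
    (H : ∀ f : X → ℝ, Measurable f → (∀ x, f x ∈ Icc (0 : ℝ) 1) → (∀ x y, f x - f y ≤ δ) →
      ∫ x, f x ∂P - ∫ x, f x ∂W ≤ d) (n : ℕ) {f : (Fin n → X) → ℝ} (hf : Measurable f)
    (h : ∀ x, f x ∈ Icc (0 : ℝ) 1) (hδ : ∀ x y, Neighbors x y → f x - f y ≤ δ) :
    ∫ x, f x ∂(Measure.pi fun _ : Fin n => P) - ∫ x, f x ∂(Measure.pi fun _ : Fin n => W)
      ≤ n * d := by
  induction n with
  | zero => rw [Measure.pi_of_empty, Measure.pi_of_empty]; simp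
  | succ n ih =>
    have hfc : Measurable fun z : X × (Fin n → X) => f (Fin.cons z.1 z.2) :=
      hf.comp (measurable_fin_cons n)
    have hfx : ∀ x₀, Measurable fun xs : Fin n → X => f (Fin.cons x₀ xs) := fun x₀ =>
      hfc.comp measurable_prodMk_left
    have hgm : ∀ ν : Measure (Fin n → X), IsProbabilityMeasure ν →
        Measurable fun x₀ => ∫ xs, f (Fin.cons x₀ xs) ∂ν := fun ν _ =>
      measurable_integral_right hfc
    have hnb : ∀ (x₀ y₀ : X) (xs : Fin n → X),
        Neighbors (Fin.cons x₀ xs : Fin (n + 1) → X) (Fin.cons y₀ xs) := fun x₀ y₀ xs =>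
      ⟨0, fun j hj => by
        obtain ⟨k, rfl⟩ := Fin.exists_succ_eq.2 hj
        simp⟩
    have hnb' : ∀ (x₀ : X) (xs ys : Fin n → X), Neighbors xs ys →
        Neighbors (Fin.cons x₀ xs : Fin (n + 1) → X) (Fin.cons x₀ ys) := by
      rintro x₀ xs ys ⟨i, hi⟩
      refine ⟨i.succ, fun j hj => ?_⟩
      induction j using Fin.cases with
      | zero => simp
      | succ k => simpa using hi k fun hk => hj (by rw [hk])
    -- Averaging over the last `n` entries preserves the range and the bounded differences, so `H`
    -- handles the first entry. The other entries are replaced by induction with the first one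
    -- fixed.
    rw [integral_pi_succ P hf h, integral_pi_succ W hf h]
    have h1 : ∫ x₀, ∫ xs, f (Fin.cons x₀ xs) ∂(Measure.pi fun _ : Fin n => P) ∂P -
        ∫ x₀, ∫ xs, f (Fin.cons x₀ xs) ∂(Measure.pi fun _ : Fin n => P) ∂W ≤ d := by
      refine H _ (hgm _ inferInstance) (fun x₀ => integral_mem_Icc (hfx x₀) fun _ => h _) ?_
      intro x y
      rw [← integral_sub (integrable_of_mem_Icc (hfx x) fun _ => h _)
        (integrable_of_mem_Icc (hfx y) fun _ => h _)]
      calc _ ≤ ∫ _, δ ∂(Measure.pi fun _ : Fin n => P) :=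
            integral_mono ((integrable_of_mem_Icc (hfx x) fun _ => h _).sub
              (integrable_of_mem_Icc (hfx y) fun _ => h _)) (integrable_const _)
              fun xs => hδ _ _ (hnb x y xs)
        _ = δ := by simp
    have h2 : ∫ x₀, ∫ xs, f (Fin.cons x₀ xs) ∂(Measure.pi fun _ : Fin n => P) ∂W -
        ∫ x₀, ∫ xs, f (Fin.cons x₀ xs) ∂(Measure.pi fun _ : Fin n => W) ∂W ≤ n * d := by
      have hi : ∀ ν : Measure (Fin n → X), IsProbabilityMeasure ν →
          Integrable (fun x₀ => ∫ xs, f (Fin.cons x₀ xs) ∂ν) W := fun ν hν =>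
        integrable_of_mem_Icc (hgm ν hν) fun x₀ => integral_mem_Icc (hfx x₀) fun _ => h _
      rw [← integral_sub (hi _ inferInstance) (hi _ inferInstance)]
      calc _ ≤ ∫ _, (n * d : ℝ) ∂W :=
            integral_mono ((hi _ inferInstance).sub (hi _ inferInstance)) (integrable_const _)
              fun x₀ => ih (hfx x₀) (fun _ => h _) fun x y hxy => hδ _ _ (hnb' x₀ x y hxy)
        _ = n * d := by simp
    push_cast
    linarith

/-! ### Hellinger affinity and tests on product measures -/

lemma integral_sqrt_mul_sqrt_le {μ : Measure X} {f g : X → ℝ} (hf : Integrable f μ)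
    (hg : Integrable g μ) (hf0 : ∀ x, 0 ≤ f x) (hg0 : ∀ x, 0 ≤ g x) :
    ∫ x, √(f x) * √(g x) ∂μ ≤ √(∫ x, f x ∂μ) * √(∫ x, g x ∂μ) := by
  have hL : ∀ k : X → ℝ, Integrable k μ → (∀ x, 0 ≤ k x) →
      MemLp (fun x => √(k x)) (ENNReal.ofReal 2) μ := fun k hk hk0 => by
    have : ENNReal.ofReal 2 = 2 := by simp
    rw [this, memLp_two_iff_integrable_sq (Real.continuous_sqrt.comp_aestronglyMeasurable hk.1)]
    simpa [Real.sq_sqrt (hk0 _)] using hk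
  have := integral_mul_le_Lp_mul_Lq_of_nonneg (μ := μ) Real.HolderConjugate.two_two
    (ae_of_all _ fun x => Real.sqrt_nonneg (f x)) (ae_of_all _ fun x => Real.sqrt_nonneg (g x))
    (hL f hf hf0) (hL g hg hg0)
  simpa only [Real.rpow_two, Real.sq_sqrt (hf0 _), Real.sq_sqrt (hg0 _), ← Real.sqrt_eq_rpow]
    using this

lemma integrable_sqrt_mul_sqrt {μ : Measure X} {f g : X → ℝ} (hf : Integrable f μ)
    (hg : Integrable g μ) (hf0 : ∀ x, 0 ≤ f x) (hg0 : ∀ x, 0 ≤ g x) :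
    Integrable (fun x => √(f x) * √(g x)) μ := by
  refine (hf.add hg).mono' ((Real.continuous_sqrt.comp_aestronglyMeasurable hf.1).mul
    (Real.continuous_sqrt.comp_aestronglyMeasurable hg.1)) (ae_of_all _ fun x => ?_)
  rw [Real.norm_of_nonneg (by positivity)]
  have := Real.sq_sqrt (hf0 x)
  have := Real.sq_sqrt (hg0 x)
  have := hf0 x
  have := hg0 x
  simp only [Pi.add_apply]
  nlinarith [sq_nonneg (√(f x) - √(g x))]

lemma integral_withDensity_coe {μ : Measure X} {q : X → ℝ≥0} (hq : Measurable q) (g : X → ℝ) :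
    ∫ x, g x ∂(μ.withDensity fun x => (q x : ℝ≥0∞)) = ∫ x, (q x : ℝ) * g x ∂μ := by
  rw [integral_withDensity_eq_integral_smul hq]; rfl

lemma integrable_coe_of_isProbabilityMeasure {μ : Measure X} {q : X → ℝ≥0} (hq : Measurable q)
    [IsProbabilityMeasure (μ.withDensity fun x => (q x : ℝ≥0∞))] :
    Integrable (fun x => (q x : ℝ)) μ := by
  have := (integrable_withDensity_iff_integrable_smul (μ := μ) hq (g := fun _ => (1 : ℝ))).1
    (integrable_const _)
  simpa [NNReal.smul_def] using this

lemma integral_coe_of_isProbabilityMeasure {μ : Measure X} {q : X → ℝ≥0} (hq : Measurable q)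
    [IsProbabilityMeasure (μ.withDensity fun x => (q x : ℝ≥0∞))] :
    ∫ x, (q x : ℝ) ∂μ = 1 := by
  simpa using (integral_withDensity_coe (μ := μ) hq fun _ => (1 : ℝ)).symm

lemma integrable_coe_mul {μ : Measure X} {q : X → ℝ≥0}
    (hi : Integrable (fun x => (q x : ℝ)) μ) {g : X → ℝ} (hg : Measurable g)
    (h : ∀ x, g x ∈ Icc (0 : ℝ) 1) : Integrable (fun x => (q x : ℝ) * g x) μ := by
  simp_rw [mul_comm]
  exact hi.bdd_mul (c := 1) hg.aestronglyMeasurable (ae_of_all _ fun x => by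
    rw [Real.norm_of_nonneg (h x).1]; exact (h x).2)

/-- Data processing for the Hellinger affinity of product measures and a two-valued output. -/
theorem pow_le_affinity_of_test {μ : Measure X} {w q : X → ℝ≥0} (hw : Measurable w)
    (hq : Measurable q) [IsProbabilityMeasure (μ.withDensity fun x => (w x : ℝ≥0∞))]
    [IsProbabilityMeasure (μ.withDensity fun x => (q x : ℝ≥0∞))] {ρ : ℝ} (hρ0 : 0 ≤ ρ)
    (hρ : ρ ≤ ∫ x, √(w x : ℝ) * √(q x : ℝ) ∂μ) (n : ℕ) {f : (Fin n → X) → ℝ}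
    (hf : Measurable f) (h : ∀ x, f x ∈ Icc (0 : ℝ) 1) :
    ρ ^ n ≤
      √(∫ x, f x ∂(Measure.pi fun _ : Fin n => μ.withDensity fun x => (w x : ℝ≥0∞))) *
        √(∫ x, f x ∂(Measure.pi fun _ : Fin n => μ.withDensity fun x => (q x : ℝ≥0∞))) +
      √(1 - ∫ x, f x ∂(Measure.pi fun _ : Fin n => μ.withDensity fun x => (w x : ℝ≥0∞))) *
        √(1 - ∫ x, f x ∂(Measure.pi fun _ : Fin n => μ.withDensity fun x => (q x : ℝ≥0∞))) := by
  set W := μ.withDensity fun x => (w x : ℝ≥0∞) with hW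
  set Q := μ.withDensity fun x => (q x : ℝ≥0∞) with hQ
  have hiw : Integrable (fun x => (w x : ℝ)) μ := integrable_coe_of_isProbabilityMeasure hw
  have hiq : Integrable (fun x => (q x : ℝ)) μ := integrable_coe_of_isProbabilityMeasure hq
  induction n with
  | zero =>
    have hWQ : (Measure.pi fun _ : Fin 0 => W) = Measure.pi fun _ : Fin 0 => Q := by
      rw [Measure.pi_of_empty, Measure.pi_of_empty]
    rw [hWQ]
    obtain ⟨h0, h1⟩ := integral_mem_Icc (ν := Measure.pi fun _ : Fin 0 => Q) hf h
    rw [Real.mul_self_sqrt h0, Real.mul_self_sqrt (by linarith)]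
    simp
  | succ n ih =>
    have hfc : Measurable fun z : X × (Fin n → X) => f (Fin.cons z.1 z.2) :=
      hf.comp (measurable_fin_cons n)
    have hfx : ∀ x₀, Measurable fun xs : Fin n → X => f (Fin.cons x₀ xs) := fun x₀ =>
      hfc.comp measurable_prodMk_left
    rw [integral_pi_succ W hf h, integral_pi_succ Q hf h]
    set u : X → ℝ := fun x₀ => ∫ xs, f (Fin.cons x₀ xs) ∂(Measure.pi fun _ : Fin n => W) with hu
    set v : X → ℝ := fun x₀ => ∫ xs, f (Fin.cons x₀ xs) ∂(Measure.pi fun _ : Fin n => Q) with hv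
    have hum : Measurable u := measurable_integral_right hfc
    have hvm : Measurable v := measurable_integral_right hfc
    have hu1 : ∀ x, u x ∈ Icc (0 : ℝ) 1 := fun x => integral_mem_Icc (hfx x) fun _ => h _
    have hv1 : ∀ x, v x ∈ Icc (0 : ℝ) 1 := fun x => integral_mem_Icc (hfx x) fun _ => h _
    have hu1' : ∀ x, 1 - u x ∈ Icc (0 : ℝ) 1 := fun x =>
      ⟨by linarith [(hu1 x).2], by linarith [(hu1 x).1]⟩
    have hv1' : ∀ x, 1 - v x ∈ Icc (0 : ℝ) 1 := fun x =>
      ⟨by linarith [(hv1 x).2], by linarith [(hv1 x).1]⟩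
    have e1 : 1 - ∫ x, u x ∂W = ∫ x, (w x : ℝ) * (1 - u x) ∂μ := by
      rw [← integral_withDensity_coe hw, integral_sub (integrable_const _)
        (integrable_of_mem_Icc hum hu1)]
      simp
      rfl
    have e2 : 1 - ∫ x, v x ∂Q = ∫ x, (q x : ℝ) * (1 - v x) ∂μ := by
      rw [← integral_withDensity_coe hq, integral_sub (integrable_const _)
        (integrable_of_mem_Icc hvm hv1)]
      simp
      rfl
    rw [e1, e2, integral_withDensity_coe hw, integral_withDensity_coe hq]
    have i1 := integrable_coe_mul hiw hum hu1
    have i2 := integrable_coe_mul hiq hvm hv1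
    have i3 := integrable_coe_mul hiw (hum.const_sub 1) hu1'
    have i4 := integrable_coe_mul hiq (hvm.const_sub 1) hv1'
    have n1 : ∀ x, 0 ≤ (w x : ℝ) * u x := fun x => mul_nonneg (w x).2 (hu1 x).1
    have n2 : ∀ x, 0 ≤ (q x : ℝ) * v x := fun x => mul_nonneg (q x).2 (hv1 x).1
    have n3 : ∀ x, 0 ≤ (w x : ℝ) * (1 - u x) := fun x => mul_nonneg (w x).2 (hu1' x).1
    have n4 : ∀ x, 0 ≤ (q x : ℝ) * (1 - v x) := fun x => mul_nonneg (q x).2 (hv1' x).1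
    -- Cauchy–Schwarz for each output reduces to a pointwise inequality, which is the induction
    -- hypothesis for the section of `f` at `x`, multiplied by `√(w x) * √(q x)`.
    refine le_trans ?_ (add_le_add (integral_sqrt_mul_sqrt_le i1 i2 n1 n2)
      (integral_sqrt_mul_sqrt_le i3 i4 n3 n4))
    rw [← integral_add (integrable_sqrt_mul_sqrt i1 i2 n1 n2)
      (integrable_sqrt_mul_sqrt i3 i4 n3 n4), pow_succ]
    calc ρ ^ n * ρ ≤ ρ ^ n * ∫ x, √(w x : ℝ) * √(q x : ℝ) ∂μ := by gcongr
      _ = ∫ x, ρ ^ n * (√(w x : ℝ) * √(q x : ℝ)) ∂μ := (integral_const_mul _ _).symm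
      _ ≤ _ := by
        refine integral_mono ((integrable_sqrt_mul_sqrt hiw hiq (fun x => (w x).2)
          fun x => (q x).2).const_mul _) ((integrable_sqrt_mul_sqrt i1 i2 n1 n2).add
          (integrable_sqrt_mul_sqrt i3 i4 n3 n4)) fun x => ?_
        have := mul_le_mul_of_nonneg_right (ih (hfx x) fun _ => h _)
          (by positivity : 0 ≤ √(w x : ℝ) * √(q x : ℝ))
        simp only [Real.sqrt_mul (w x).coe_nonneg, Real.sqrt_mul (q x).coe_nonneg]
        simp only [hu, hv]
        linarith

/-- The distinguishing advantage between product measures in terms of the Hellinger affinity. -/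
theorem integral_pi_sub_sq_le {μ : Measure X} {w q : X → ℝ≥0} (hw : Measurable w)
    (hq : Measurable q) [IsProbabilityMeasure (μ.withDensity fun x => (w x : ℝ≥0∞))]
    [IsProbabilityMeasure (μ.withDensity fun x => (q x : ℝ≥0∞))] {h : ℝ} (hh1 : h ≤ 1)
    (hρ : 1 - h ≤ ∫ x, √(w x : ℝ) * √(q x : ℝ) ∂μ) (n : ℕ) {f : (Fin n → X) → ℝ}
    (hf : Measurable f) (hf1 : ∀ x, f x ∈ Icc (0 : ℝ) 1) :
    (∫ x, f x ∂(Measure.pi fun _ : Fin n => μ.withDensity fun x => (w x : ℝ≥0∞)) -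
      ∫ x, f x ∂(Measure.pi fun _ : Fin n => μ.withDensity fun x => (q x : ℝ≥0∞))) ^ 2
      ≤ 2 * n * h := by
  have key := pow_le_affinity_of_test hw hq (sub_nonneg.2 hh1) hρ n hf hf1
  set u := ∫ x, f x ∂(Measure.pi fun _ : Fin n => μ.withDensity fun x => (w x : ℝ≥0∞))
    with hu
  set v := ∫ x, f x ∂(Measure.pi fun _ : Fin n => μ.withDensity fun x => (q x : ℝ≥0∞))
    with hv
  have hu1 : u ∈ Icc (0 : ℝ) 1 := integral_mem_Icc hf hf1
  have hv1 : v ∈ Icc (0 : ℝ) 1 := integral_mem_Icc hf hf1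
  have s1 := Real.sq_sqrt hu1.1
  have s2 := Real.sq_sqrt hv1.1
  have s3 := Real.sq_sqrt (sub_nonneg.2 hu1.2)
  have s4 := Real.sq_sqrt (sub_nonneg.2 hv1.2)
  generalize √u = A at *
  generalize √v = B at *
  generalize √(1 - u) = C at *
  generalize √(1 - v) = D at *
  have hb : 1 - 2 * n * h ≤ ((1 - h) ^ n) ^ 2 := by
    have := one_add_mul_le_pow (a := -h) (by linarith) (n * 2)
    rw [← pow_mul]
    push_cast at this
    calc 1 - 2 * n * h = 1 + n * 2 * -h := by ring
      _ ≤ _ := by rwa [sub_eq_add_neg]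
  have hk : ((1 - h) ^ n) ^ 2 ≤ (A * B + C * D) ^ 2 :=
    pow_le_pow_left₀ (pow_nonneg (sub_nonneg.2 hh1) _) key 2
  -- `(A, C)` and `(B, D)` are unit vectors. Their inner product is `A * B + C * D`, the sine of
  -- their angle is `A * D - B * C` up to sign, and `u - v` is this sine times `A * D + B * C`,
  -- which is at most one in absolute value.
  have hid : (u - v) ^ 2 + (A * B + C * D) ^ 2 ≤ 1 := by
    have hA : A ^ 2 + C ^ 2 = 1 := by linarith
    have hB : B ^ 2 + D ^ 2 = 1 := by linarith
    have h1 : u - v = (A * D - B * C) * (A * D + B * C) := by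
      rw [← s1, ← s2]; linear_combination -(A ^ 2) * hB + B ^ 2 * hA
    have h2 : (A * B + C * D) ^ 2 + (A * D - B * C) ^ 2 = 1 := by
      linear_combination (B ^ 2 + D ^ 2) * hA + hB
    have h3 : (A * D + B * C) ^ 2 ≤ 1 := by
      nlinarith [sq_nonneg (A * B - C * D)]
    rw [h1, mul_pow]
    nlinarith [mul_le_mul_of_nonneg_left h3 (sq_nonneg (A * D - B * C))]
  linarith

end Product

/-! ### Clamped pairs of densities -/

/-- `pt` and `qt` are parts of mass `1 - τ` of the probability densities `p` and `q`, with
log-likelihood ratio `L` in `[a, b]` and Hellinger affinity `1 - τ - h`. The remaining part of `p`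
is concentrated on `L = b`, and the remaining part of `q` on `L = a`. -/
structure ClampedSplit {X : Type*} [MeasurableSpace X] (μ : Measure X) (p q pt qt : X → ℝ≥0)
    (L : X → ℝ) (a b τ h : ℝ) : Prop where
  measurable_p : Measurable p
  measurable_q : Measurable q
  measurable_pt : Measurable pt
  measurable_qt : Measurable qt
  measurable_L : Measurable L
  prob_p : IsProbabilityMeasure (μ.withDensity fun x => (p x : ℝ≥0∞))
  prob_q : IsProbabilityMeasure (μ.withDensity fun x => (q x : ℝ≥0∞))
  pt_le : ∀ x, pt x ≤ p x
  qt_le : ∀ x, qt x ≤ q x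
  exp_mul : ∀ x, Real.exp (L x) * (qt x : ℝ) = pt x
  eq_b : ∀ x, pt x < p x → L x = b
  eq_a : ∀ x, qt x < q x → L x = a
  a_le : ∀ x, a ≤ L x
  le_b : ∀ x, L x ≤ b
  a_nonpos : a ≤ 0
  b_nonneg : 0 ≤ b
  integral_pt : ∫ x, (pt x : ℝ) ∂μ = 1 - τ
  integral_qt : ∫ x, (qt x : ℝ) ∂μ = 1 - τ
  affinity : ∫ x, √(pt x : ℝ) * √(qt x : ℝ) ∂μ = 1 - τ - h

namespace ClampedSplit

variable {X : Type*} [MeasurableSpace X] {μ : Measure X} {p q pt qt : X → ℝ≥0} {L : X → ℝ}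
  {a b τ h : ℝ}

/-- The setting is invariant under interchanging the distributions and negating `L`. One-sample
statements under `P` follow in this way from those under `Q`. -/
theorem symm (S : ClampedSplit μ p q pt qt L a b τ h) :
    ClampedSplit μ q p qt pt (fun x => -L x) (-b) (-a) τ h where
  measurable_p := S.measurable_q
  measurable_q := S.measurable_p
  measurable_pt := S.measurable_qt
  measurable_qt := S.measurable_pt
  measurable_L := S.measurable_L.neg
  prob_p := S.prob_q
  prob_q := S.prob_p
  pt_le := S.qt_le
  qt_le := S.pt_le
  exp_mul x := by
    rw [← S.exp_mul x, ← mul_assoc, ← Real.exp_add]; simp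
  eq_b x hx := by rw [S.eq_a x hx]
  eq_a x hx := by rw [S.eq_b x hx]
  a_le x := neg_le_neg (S.le_b x)
  le_b x := neg_le_neg (S.a_le x)
  a_nonpos := neg_nonpos.2 S.b_nonneg
  b_nonneg := neg_nonneg.2 S.a_nonpos
  integral_pt := S.integral_qt
  integral_qt := S.integral_pt
  affinity := by simpa only [mul_comm] using S.affinity

variable (S : ClampedSplit μ p q pt qt L a b τ h)
include S

lemma integrable_q : Integrable (fun x => (q x : ℝ)) μ :=
  have := S.prob_q
  integrable_coe_of_isProbabilityMeasure S.measurable_q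

lemma integrable_qt : Integrable (fun x => (qt x : ℝ)) μ :=
  S.integrable_q.mono' S.measurable_qt.coe_nnreal_real.aestronglyMeasurable
    (ae_of_all _ fun x => by
      rw [Real.norm_of_nonneg (qt x).coe_nonneg]; exact S.qt_le x)

lemma integrable_pt : Integrable (fun x => (pt x : ℝ)) μ := S.symm.integrable_qt

lemma integral_q : ∫ x, (q x : ℝ) ∂μ = 1 :=
  have := S.prob_q
  integral_coe_of_isProbabilityMeasure S.measurable_q

lemma tau_nonneg : 0 ≤ τ := by
  have : ∫ x, (qt x : ℝ) ∂μ ≤ ∫ x, (q x : ℝ) ∂μ :=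
    integral_mono S.integrable_qt S.integrable_q fun x => S.qt_le x
  rw [S.integral_qt, S.integral_q] at this
  linarith

lemma tau_le_one : τ ≤ 1 := by
  have : 0 ≤ ∫ x, (qt x : ℝ) ∂μ := integral_nonneg fun x => (qt x).2
  rw [S.integral_qt] at this
  linarith

lemma h_nonneg : 0 ≤ h := by
  have : ∫ x, √(pt x : ℝ) * √(qt x : ℝ) ∂μ ≤ √(∫ x, (pt x : ℝ) ∂μ) * √(∫ x, (qt x : ℝ) ∂μ) :=
    integral_sqrt_mul_sqrt_le S.integrable_pt S.integrable_qt (fun x => (pt x).2)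
      fun x => (qt x).2
  rw [S.affinity, S.integral_pt, S.integral_qt,
    Real.mul_self_sqrt (by linarith [S.tau_le_one])] at this
  linarith

lemma h_le : h ≤ 1 - τ := by
  have : 0 ≤ ∫ x, √(pt x : ℝ) * √(qt x : ℝ) ∂μ := integral_nonneg fun x => by positivity
  rw [S.affinity] at this
  linarith

/-- Links the exponential moment of order `1 / 2` to the affinity, and thus the Chernoff rate to
`h`. -/
lemma sqrt_mul_sqrt (x : X) :
    √(pt x : ℝ) * √(qt x : ℝ) = Real.exp (1 / 2 * L x) * (qt x : ℝ) := by
  rw [← S.exp_mul x, Real.sqrt_mul (Real.exp_nonneg _), ← Real.exp_half, mul_assoc,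
    Real.mul_self_sqrt (qt x).coe_nonneg]
  congr 2
  ring

/-- Functions of `L` are bounded, and integrable against any finite density. -/
lemma integrable_comp_mul {f : ℝ → ℝ} (hf : Continuous f) {g : X → ℝ} (hg : Integrable g μ) :
    Integrable (fun x => f (L x) * g x) μ := by
  obtain ⟨C, hC⟩ := isCompact_Icc.exists_bound_of_continuousOn (s := Icc a b) hf.continuousOn
  exact hg.bdd_mul (hf.measurable.comp S.measurable_L).aestronglyMeasurable
    (ae_of_all _ fun x => hC _ ⟨S.a_le x, S.le_b x⟩)

/-- The leftover `q - qt` has mass `τ` and lives on `L = a`, so for functions of `L` it acts as a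
point mass at `a`. -/
lemma integral_comp_Q {f : ℝ → ℝ} (hf : Continuous f) :
    ∫ x, f (L x) ∂(μ.withDensity fun x => (q x : ℝ≥0∞)) =
      ∫ x, f (L x) * (qt x : ℝ) ∂μ + f a * τ := by
  have i1 := S.integrable_comp_mul hf S.integrable_q
  have i2 := S.integrable_comp_mul hf S.integrable_qt
  have hτ : f a * τ = ∫ x, (f (L x) * (q x : ℝ) - f (L x) * (qt x : ℝ)) ∂μ := by
    calc f a * τ = f a * (∫ x, (q x : ℝ) ∂μ - ∫ x, (qt x : ℝ) ∂μ) := by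
          rw [S.integral_q, S.integral_qt]; ring
      _ = ∫ x, f a * ((q x : ℝ) - qt x) ∂μ := by
          rw [integral_const_mul, integral_sub S.integrable_q S.integrable_qt]
      _ = _ := by
          refine integral_congr_ae (ae_of_all _ fun x => ?_)
          rcases (S.qt_le x).lt_or_eq with hx | hx
          · simp only [S.eq_a x hx]; ring
          · simp only [hx]; ring
  rw [integral_withDensity_coe S.measurable_q, hτ, integral_sub i1 i2]
  simp only [mul_comm]
  ring

lemma integral_comp_P {f : ℝ → ℝ} (hf : Continuous f) :
    ∫ x, f (L x) ∂(μ.withDensity fun x => (p x : ℝ≥0∞)) =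
      ∫ x, f (L x) * (pt x : ℝ) ∂μ + f b * τ := by
  simpa using S.symm.integral_comp_Q (f := fun t => f (-t)) (hf.comp continuous_neg)

/-- The exponential moments of order at most one under the second distribution. -/
theorem integral_exp_Q_le {l : ℝ} (hl0 : 0 ≤ l) (hl1 : l ≤ 1) :
    ∫ x, Real.exp (l * L x) ∂(μ.withDensity fun x => (q x : ℝ≥0∞)) ≤ 1 := by
  have hc : Continuous fun t : ℝ => Real.exp (l * t) := by fun_prop
  rw [S.integral_comp_Q hc]
  -- By convexity `exp (l * L) ≤ l * exp L + (1 - l)`, and `exp L` turns `qt` into `pt`, which has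
  -- the same mass.
  have h1 : ∫ x, Real.exp (l * L x) * (qt x : ℝ) ∂μ ≤
      ∫ x, (l * (pt x : ℝ) + (1 - l) * (qt x : ℝ)) ∂μ := by
    refine integral_mono (S.integrable_comp_mul hc S.integrable_qt)
      ((S.integrable_pt.const_mul l).add (S.integrable_qt.const_mul (1 - l))) fun x => ?_
    have := convexOn_exp.2 (mem_univ (L x)) (mem_univ 0) hl0 (sub_nonneg.2 hl1) (by ring)
    simp only [smul_eq_mul, mul_zero, add_zero, Real.exp_zero, mul_one] at this
    calc Real.exp (l * L x) * (qt x : ℝ) ≤ (l * Real.exp (L x) + (1 - l)) * (qt x : ℝ) :=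
          mul_le_mul_of_nonneg_right this (qt x).2
      _ = _ := by rw [← S.exp_mul x]; ring
  rw [integral_add (S.integrable_pt.const_mul l) (S.integrable_qt.const_mul (1 - l)),
    integral_const_mul, integral_const_mul, S.integral_pt, S.integral_qt] at h1
  have h2 : Real.exp (l * a) ≤ 1 :=
    Real.exp_le_one_iff.2 (mul_nonpos_of_nonneg_of_nonpos hl0 S.a_nonpos)
  nlinarith [S.tau_nonneg]

theorem integral_exp_P_le {l : ℝ} (hl0 : 0 ≤ l) (hl1 : l ≤ 1) :
    ∫ x, Real.exp (-(l * L x)) ∂(μ.withDensity fun x => (p x : ℝ≥0∞)) ≤ 1 := by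
  simpa using S.symm.integral_exp_Q_le hl0 hl1

theorem integral_exp_half_Q :
    ∫ x, Real.exp (1 / 2 * L x) ∂(μ.withDensity fun x => (q x : ℝ≥0∞)) =
      1 - h - (1 - Real.exp (1 / 2 * a)) * τ := by
  rw [S.integral_comp_Q (f := fun t => Real.exp (1 / 2 * t)) (by fun_prop)]
  simp_rw [← S.sqrt_mul_sqrt]
  rw [S.affinity]
  ring

theorem integral_exp_half_Q_le {ε : ℝ} (hε : 0 < ε) (ha : a = -ε) :
    ∫ x, Real.exp (1 / 2 * L x) ∂(μ.withDensity fun x => (q x : ℝ≥0∞)) ≤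
      Real.exp (-((min ε 1 * τ + h) / 3)) := by
  rw [S.integral_exp_half_Q]
  have hm0 : 0 < min ε 1 := lt_min hε one_pos
  have hm1 : min ε 1 ≤ 1 := min_le_right _ _
  -- With `m = min ε 1`, the bound `1 / (1 + m / 2) ≤ 1 - m / 3` holds because `m ≤ 1`; this is the
  -- source of the `3` in the exponent.
  have h1 : Real.exp (1 / 2 * a) ≤ 1 - min ε 1 / 3 := by
    have h2 : (1 + min ε 1 / 2) * Real.exp (1 / 2 * a) ≤ 1 := by
      calc _ ≤ Real.exp (min ε 1 / 2) * Real.exp (1 / 2 * a) := by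
            gcongr
            linarith [Real.add_one_le_exp (min ε 1 / 2)]
        _ = Real.exp (min ε 1 / 2 + 1 / 2 * a) := (Real.exp_add _ _).symm
        _ ≤ 1 := Real.exp_le_one_iff.2 (by rw [ha]; linarith [min_le_left ε 1])
    nlinarith [Real.exp_pos (1 / 2 * a)]
  have h3 := Real.add_one_le_exp (-((min ε 1 * τ + h) / 3))
  nlinarith [S.tau_nonneg, S.h_nonneg]

theorem integral_exp_half_P_le {ε : ℝ} (hε : 0 < ε) (hb : b = ε) :
    ∫ x, Real.exp (-(1 / 2 * L x)) ∂(μ.withDensity fun x => (p x : ℝ≥0∞)) ≤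
      Real.exp (-((min ε 1 * τ + h) / 3)) := by
  simpa using S.symm.integral_exp_half_Q_le hε (by rw [hb])

/-- The advantage of the soft test with offset zero on one sample. -/
theorem integral_soft_sub :
    ∫ x, Real.exp (1 / 2 * L x) / (Real.exp (1 / 2 * L x) + 1)
        ∂(μ.withDensity fun x => (p x : ℝ≥0∞)) -
      ∫ x, Real.exp (1 / 2 * L x) / (Real.exp (1 / 2 * L x) + 1)
        ∂(μ.withDensity fun x => (q x : ℝ≥0∞)) =
      h + τ * (Real.exp (1 / 2 * b) / (Real.exp (1 / 2 * b) + 1) -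
        Real.exp (1 / 2 * a) / (Real.exp (1 / 2 * a) + 1)) := by
  have hc : Continuous fun t : ℝ => Real.exp (1 / 2 * t) / (Real.exp (1 / 2 * t) + 1) :=
    Continuous.div (by fun_prop) (by fun_prop) fun t => by positivity
  rw [S.integral_comp_P hc, S.integral_comp_Q hc]
  -- With `u = exp (L / 2)` one has `pt = u ^ 2 * qt`, so `u / (u + 1) * (pt - qt) = (u ^ 2 - u) *
  -- qt = pt - √(pt * qt)`.
  have key : ∫ x, Real.exp (1 / 2 * L x) / (Real.exp (1 / 2 * L x) + 1) * (pt x : ℝ) ∂μ -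
      ∫ x, Real.exp (1 / 2 * L x) / (Real.exp (1 / 2 * L x) + 1) * (qt x : ℝ) ∂μ = h := by
    rw [← integral_sub (S.integrable_comp_mul hc S.integrable_pt)
      (S.integrable_comp_mul hc S.integrable_qt)]
    calc _ = ∫ x, ((pt x : ℝ) - √(pt x : ℝ) * √(qt x : ℝ)) ∂μ := by
          refine integral_congr_ae (ae_of_all _ fun x => ?_)
          have h1 : (pt x : ℝ) = Real.exp (1 / 2 * L x) ^ 2 * qt x := by
            rw [← S.exp_mul x, ← Real.exp_nat_mul]
            congr 2
            push_cast
            ring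
          simp only [S.sqrt_mul_sqrt]
          rw [h1]
          have := Real.exp_pos (1 / 2 * L x)
          field_simp
          ring
      _ = h := by
          rw [integral_sub S.integrable_pt (integrable_sqrt_mul_sqrt S.integrable_pt
            S.integrable_qt (fun x => (pt x).2) fun x => (qt x).2), S.affinity, S.integral_pt]
          ring
  linear_combination key

/-- An upper bound on the advantage of any test with bounded differences. -/
theorem adv_le_of_bounded_differences {δ : ℝ} {n : ℕ} {f : (Fin n → X) → ℝ}
    (hf : Measurable f) (hf1 : ∀ x, f x ∈ Icc (0 : ℝ) 1)
    (hδ : ∀ x y, Neighbors x y → f x - f y ≤ δ) :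
    ∫ x, f x ∂(Measure.pi fun _ : Fin n => μ.withDensity fun x => (p x : ℝ≥0∞)) -
      ∫ x, f x ∂(Measure.pi fun _ : Fin n => μ.withDensity fun x => (q x : ℝ≥0∞)) ≤
      n * (δ * τ) + √(2 * n * h) := by
  -- The intermediate density: the clamped part of `p` with the leftover of `q`.
  set w : X → ℝ≥0 := fun x => pt x + (q x - qt x) with hw
  have hwx : ∀ x, (w x : ℝ) = pt x + (q x - qt x) := fun x => by
    simp only [hw]
    rw [NNReal.coe_add, NNReal.coe_sub (S.qt_le x)]
  have hwm : Measurable w := S.measurable_pt.add (S.measurable_q.sub S.measurable_qt)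
  have hr : Integrable (fun x => (q x : ℝ) - qt x) μ := S.integrable_q.sub S.integrable_qt
  have hiw : Integrable (fun x => (w x : ℝ)) μ := by
    simp_rw [hwx]
    exact S.integrable_pt.add hr
  have hw1 : ∫ x, (w x : ℝ) ∂μ = 1 := by
    simp_rw [hwx]
    rw [integral_add S.integrable_pt hr, integral_sub S.integrable_q S.integrable_qt,
      S.integral_pt, S.integral_q, S.integral_qt]
    ring
  have hwP : IsProbabilityMeasure (μ.withDensity fun x => (w x : ℝ≥0∞)) := by
    constructor
    rw [withDensity_apply _ MeasurableSet.univ, Measure.restrict_univ,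
      lintegral_coe_eq_integral _ hiw, hw1, ENNReal.ofReal_one]
  have := S.prob_p
  have := S.prob_q
  have hPW := integral_pi_sub_le_of_bounded_differences
    (μ.withDensity fun x => (p x : ℝ≥0∞)) (μ.withDensity fun x => (w x : ℝ≥0∞))
    (δ := δ) (d := δ * τ) ?_ n hf hf1 hδ
  · have hWQ := integral_pi_sub_sq_le (μ := μ) (h := h) hwm S.measurable_q
      (by linarith [S.h_le, S.tau_nonneg]) ?_ n hf hf1
    · have := Real.le_sqrt_of_sq_le hWQ
      linarith
    · have i1 := integrable_sqrt_mul_sqrt S.integrable_pt S.integrable_qt (fun x => (pt x).2)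
        fun x => (qt x).2
      calc 1 - h = ∫ x, (√(pt x : ℝ) * √(qt x : ℝ) + ((q x : ℝ) - qt x)) ∂μ := by
            rw [integral_add i1 hr, integral_sub S.integrable_q S.integrable_qt, S.affinity,
              S.integral_q, S.integral_qt]
            ring
        _ ≤ _ := by
            refine integral_mono (i1.add hr) (integrable_sqrt_mul_sqrt hiw S.integrable_q
              (fun x => (w x).2) fun x => (q x).2) fun x => ?_
            simp only
            rw [hwx, ← Real.sqrt_mul (x := (pt x : ℝ) + (q x - qt x)) (by rw [← hwx]; exact (w x).2)]
            have h1 := Real.sq_sqrt (pt x).coe_nonneg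
            have h2 := Real.sq_sqrt (qt x).coe_nonneg
            have h3 : (0 : ℝ) ≤ q x - qt x := sub_nonneg.2 (S.qt_le x)
            have h4 := Real.sqrt_nonneg (pt x : ℝ)
            have h5 := Real.sqrt_nonneg (qt x : ℝ)
            -- Writing `r = q - qt`, the difference `(pt + r) * (qt + r) - (√pt * √qt + r) ^ 2`
            -- equals `r * (√pt - √qt) ^ 2`.
            refine Real.le_sqrt_of_sq_le ?_
            obtain ⟨r, h6⟩ : ∃ r, (q x : ℝ) = r + qt x := ⟨q x - qt x, by ring⟩
            rw [h6, add_sub_cancel_right] at h3 ⊢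
            obtain ⟨A, h7⟩ : ∃ A, √(pt x : ℝ) = A := ⟨_, rfl⟩
            obtain ⟨B, h8⟩ : ∃ B, √(qt x : ℝ) = B := ⟨_, rfl⟩
            rw [h7] at h1 h4 ⊢
            rw [h8] at h2 h5 ⊢
            rw [← h1, ← h2]
            nlinarith [mul_nonneg h3 (sq_nonneg (A - B))]
  · intro g hg hg1 hgδ
    have : Nonempty X := (μ.withDensity fun x => (p x : ℝ≥0∞)).nonempty_of_neZero
    -- All values of `g` lie in `[iInf g, iInf g + δ]`. Bounding `g` above on `p - pt` and below on
    -- `q - qt`, which both have mass `τ`, gives `δ * τ`.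
    have hbdd : BddBelow (range g) := ⟨0, by rintro _ ⟨x, rfl⟩; exact (hg1 x).1⟩
    have hlo : ∀ x, iInf g ≤ g x := fun x => ciInf_le hbdd x
    have hhi : ∀ x, g x ≤ iInf g + δ := fun x => by
      have : g x - δ ≤ iInf g := le_ciInf fun y => by linarith [hgδ x y]
      linarith
    have ip := integrable_coe_mul S.symm.integrable_q hg hg1
    have iw := integrable_coe_mul hiw hg hg1
    rw [integral_withDensity_coe S.measurable_p, integral_withDensity_coe hwm,
      ← integral_sub ip iw]
    have hs : Integrable (fun x => (p x : ℝ) - pt x) μ :=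
      S.symm.integrable_q.sub S.integrable_pt
    calc _ ≤ ∫ x, ((iInf g + δ) * ((p x : ℝ) - pt x) - iInf g * ((q x : ℝ) - qt x)) ∂μ := by
          refine integral_mono (ip.sub iw) ((hs.const_mul _).sub (hr.const_mul _)) fun x => ?_
          have h1 : (0 : ℝ) ≤ p x - pt x := sub_nonneg.2 (S.pt_le x)
          have h2 : (0 : ℝ) ≤ q x - qt x := sub_nonneg.2 (S.qt_le x)
          simp only [hwx]
          nlinarith [mul_le_mul_of_nonneg_right (hhi x) h1, mul_le_mul_of_nonneg_right (hlo x) h2]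
      _ = δ * τ := by
          rw [integral_sub (hs.const_mul _) (hr.const_mul _), integral_const_mul,
            integral_const_mul, integral_sub S.symm.integrable_q S.integrable_pt,
            integral_sub S.integrable_q S.integrable_qt, S.symm.integral_q, S.integral_q,
            S.integral_pt, S.integral_qt]
          ring

end ClampedSplit

/-! ### Clamping probability densities -/

section Clamp

variable {X : Type*} {p q : X → ℝ≥0}

/-- The unnormalized clamped density `min (exp c * q, p)`. -/
def clampedDensity (c : ℝ) (p q : X → ℝ≥0) (x : X) : ℝ≥0 :=
  min ((Real.exp c).toNNReal * q x) (p x)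

lemma coe_clampedDensity (c : ℝ) (p q : X → ℝ≥0) (x : X) :
    (clampedDensity c p q x : ℝ) = min (Real.exp c * (q x : ℝ)) (p x : ℝ) := by
  simp [clampedDensity, Real.coe_toNNReal _ (Real.exp_nonneg c)]

lemma clampedLog_eq_toReal (p q : X → ℝ≥0) {a b : ℝ} (x : X) :
    ((clampedLog p q a b x : ℝ) : EReal) =
      max (a : EReal) (min (ENNReal.log ((p x : ℝ≥0∞) / (q x : ℝ≥0∞))) (b : EReal)) := by
  refine EReal.coe_toReal (fun h => ?_) fun h => ?_
  · rcases max_eq_top.1 h with h | h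
    · exact EReal.coe_ne_top a h
    · exact EReal.coe_ne_top b (min_eq_top.1 h).2
  · exact EReal.coe_ne_bot a (max_eq_bot.1 h).1

lemma le_clampedLog (p q : X → ℝ≥0) {a b : ℝ} (x : X) : a ≤ clampedLog p q a b x := by
  rw [← EReal.coe_le_coe_iff, clampedLog_eq_toReal]
  exact le_max_left _ _

lemma clampedLog_le (p q : X → ℝ≥0) {a b : ℝ} (hab : a ≤ b) (x : X) :
    clampedLog p q a b x ≤ b := by
  rw [← EReal.coe_le_coe_iff, clampedLog_eq_toReal]
  exact max_le (EReal.coe_le_coe_iff.2 hab) (min_le_right _ _)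

lemma clampedLog_of_pos {a b : ℝ} {x : X} (hp : 0 < p x) (hq : 0 < q x) :
    clampedLog p q a b x = max a (min (Real.log ((p x : ℝ) / q x)) b) := by
  rw [← EReal.coe_eq_coe_iff, clampedLog_eq_toReal, ← ENNReal.coe_div hq.ne',
    ENNReal.log_of_nnreal (div_pos hp hq).ne', EReal.coe_strictMono.monotone.map_max,
    EReal.coe_strictMono.monotone.map_min, NNReal.coe_div]

lemma exp_clampedLog_of_pos {a b : ℝ} {x : X} (hp : 0 < p x) (hq : 0 < q x) :
    Real.exp (clampedLog p q a b x) =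
      max (Real.exp a) (min ((p x : ℝ) / q x) (Real.exp b)) := by
  rw [clampedLog_of_pos hp hq, Real.exp_monotone.map_max, Real.exp_monotone.map_min,
    Real.exp_log (div_pos (NNReal.coe_pos.2 hp) (NNReal.coe_pos.2 hq))]

/-- Clamping the ratio from above amounts to cutting `p` down, and clamping it from below to cutting
`q` down. As `a ≤ 0 ≤ b`, at most one cut is active at a point; where `p` or `q` vanishes, both
sides are zero. -/
lemma exp_clampedLog_mul {a b : ℝ} (ha : a ≤ 0) (hb : 0 ≤ b) (x : X) :
    Real.exp (clampedLog p q a b x) * (clampedDensity (-a) q p x : ℝ) =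
      clampedDensity b p q x := by
  rw [coe_clampedDensity, coe_clampedDensity]
  rcases (zero_le (a := p x)).eq_or_lt with hp | hp
  · rw [← hp]
    simp [Real.exp_nonneg, mul_nonneg]
  rcases (zero_le (a := q x)).eq_or_lt with hq | hq
  · rw [← hq]
    simp [Real.exp_nonneg, mul_nonneg]
  rw [exp_clampedLog_of_pos hp hq]
  have hp' : (0 : ℝ) < p x := hp
  have hq' : (0 : ℝ) < q x := hq
  have ha1 : Real.exp a ≤ 1 := Real.exp_le_one_iff.2 ha
  have hb1 : 1 ≤ Real.exp b := Real.one_le_exp hb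
  have ha0 := Real.exp_pos a
  rw [Real.exp_neg]
  rcases le_total (p x : ℝ) (Real.exp a * q x) with h1 | h1
  · have h2 : (p x : ℝ) / q x ≤ Real.exp a := by rwa [div_le_iff₀ hq']
    have h3 : (Real.exp a)⁻¹ * p x ≤ q x := by rwa [inv_mul_le_iff₀ ha0]
    rw [min_eq_left (h2.trans (ha1.trans hb1)), max_eq_left h2, min_eq_left h3,
      min_eq_right (by nlinarith)]
    field_simp
  · have h2 : Real.exp a ≤ (p x : ℝ) / q x := by rwa [le_div_iff₀ hq']
    have h3 : (q x : ℝ) ≤ (Real.exp a)⁻¹ * p x := by rwa [le_inv_mul_iff₀ ha0]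
    rw [max_eq_right (le_min h2 (ha1.trans hb1)), min_eq_right h3,
      min_mul_of_nonneg _ _ hq'.le, div_mul_cancel₀ _ hq'.ne', min_comm]

lemma clampedLog_eq_right {a b : ℝ} (hab : a ≤ b) {x : X} (h : clampedDensity b p q x < p x) :
    clampedLog p q a b x = b := by
  have h1 : Real.exp b * (q x : ℝ) < p x := by
    rw [← NNReal.coe_lt_coe, coe_clampedDensity] at h
    simpa using h
  have hp : 0 < p x := pos_of_gt h
  rcases (zero_le (a := q x)).eq_or_lt with hq | hq
  · rw [← EReal.coe_eq_coe_iff, clampedLog_eq_toReal, ← hq, ENNReal.coe_zero,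
      ENNReal.div_zero (by simpa using hp.ne'), ENNReal.log_top, min_eq_right le_top,
      max_eq_right (EReal.coe_le_coe_iff.2 hab)]
  · have hq' : (0 : ℝ) < q x := hq
    have h2 : b ≤ Real.log ((p x : ℝ) / q x) := by
      rw [Real.le_log_iff_exp_le (div_pos (NNReal.coe_pos.2 hp) hq'), le_div_iff₀ hq']
      exact h1.le
    rw [clampedLog_of_pos hp hq, min_eq_right h2, max_eq_right hab]

lemma clampedLog_eq_left {a b : ℝ} {x : X} (h : clampedDensity (-a) q p x < q x) :
    clampedLog p q a b x = a := by
  have h1 : Real.exp (-a) * (p x : ℝ) < q x := by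
    rw [← NNReal.coe_lt_coe, coe_clampedDensity] at h
    simpa using h
  have hq : 0 < q x := pos_of_gt h
  rcases (zero_le (a := p x)).eq_or_lt with hp | hp
  · rw [← EReal.coe_eq_coe_iff, clampedLog_eq_toReal, ← hp, ENNReal.coe_zero,
      ENNReal.zero_div, ENNReal.log_zero, min_eq_left bot_le, max_eq_left bot_le]
  · have hq' : (0 : ℝ) < q x := hq
    have h2 : Real.log ((p x : ℝ) / q x) ≤ a := by
      rw [Real.log_le_iff_le_exp (div_pos (NNReal.coe_pos.2 hp) hq'), div_le_iff₀ hq']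
      rw [Real.exp_neg, inv_mul_lt_iff₀ (Real.exp_pos a)] at h1
      exact h1.le
    rw [clampedLog_of_pos hp hq, max_eq_left ((min_le_left _ _).trans h2)]

variable [MeasurableSpace X] {μ : Measure X}

lemma measurable_clampedDensity (c : ℝ) (hp : Measurable p) (hq : Measurable q) :
    Measurable (clampedDensity c p q) :=
  (hq.const_mul _).min hp

lemma integrable_hockeyStick (hp : Integrable (fun x => (p x : ℝ)) μ) (hq : Measurable q) (y : ℝ) :
    Integrable (fun x => max ((p x : ℝ) - Real.exp y * (q x : ℝ)) 0) μ := by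
  refine hp.mono' ((hp.1.sub (hq.coe_nnreal_real.const_mul _).aestronglyMeasurable).sup
    aestronglyMeasurable_const) (ae_of_all _ fun x => ?_)
  rw [Real.norm_of_nonneg (le_max_right _ _)]
  exact max_le (sub_le_self _ (by positivity)) (p x).coe_nonneg

/-- The mass cut off is the hockey-stick divergence, so choosing both exponents at the level `τ`
removes the same mass from `p` and `q`. -/
lemma integral_clampedDensity (hp : Integrable (fun x => (p x : ℝ)) μ) (hq : Measurable q)
    (y : ℝ) :
    ∫ x, (clampedDensity y p q x : ℝ) ∂μ = ∫ x, (p x : ℝ) ∂μ - hockeyStick μ p q y := by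
  rw [hockeyStick, ← integral_sub hp (integrable_hockeyStick hp hq y)]
  refine integral_congr_ae (ae_of_all _ fun x => ?_)
  simp only [coe_clampedDensity]
  rcases le_total (Real.exp y * (q x : ℝ)) (p x) with h | h
  · rw [min_eq_left h, max_eq_left (sub_nonneg.2 h)]; ring
  · rw [min_eq_right h, max_eq_right (sub_nonpos.2 h)]; ring

lemma continuous_hockeyStick (hp : Integrable (fun x => (p x : ℝ)) μ) (hq : Measurable q) :
    Continuous (hockeyStick μ p q) := by
  refine continuous_of_dominated (bound := fun x => (p x : ℝ))
    (fun y => (integrable_hockeyStick hp hq y).1) (fun y => ae_of_all _ fun x => ?_) hp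
    (ae_of_all _ fun x => by fun_prop)
  rw [Real.norm_of_nonneg (le_max_right _ _)]
  exact max_le (sub_le_self _ (by positivity)) (p x).coe_nonneg

lemma antitone_hockeyStick (hp : Integrable (fun x => (p x : ℝ)) μ) (hq : Measurable q) :
    Antitone (hockeyStick μ p q) := fun y z hyz =>
  integral_mono (integrable_hockeyStick hp hq z) (integrable_hockeyStick hp hq y) fun x => by
    simp only
    gcongr

/-- At exponent zero both divergences are the common mass minus `∫ min p q`. -/
lemma hockeyStick_zero_comm (hp : Measurable p) (hq : Measurable q)
    (hip : Integrable (fun x => (p x : ℝ)) μ) (hiq : Integrable (fun x => (q x : ℝ)) μ)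
    (hpq : ∫ x, (p x : ℝ) ∂μ = ∫ x, (q x : ℝ) ∂μ) :
    hockeyStick μ p q 0 = hockeyStick μ q p 0 := by
  have h1 := integral_clampedDensity hip hq 0
  have h2 := integral_clampedDensity hiq hp 0
  have h3 : ∫ x, (clampedDensity 0 p q x : ℝ) ∂μ = ∫ x, (clampedDensity 0 q p x : ℝ) ∂μ :=
    integral_congr_ae (ae_of_all _ fun x => by simp [coe_clampedDensity, min_comm])
  linarith

lemma tau_comm (ε : ℝ) : tau μ p q ε = tau μ q p ε := max_comm _ _

/-- The level `τ` lies between the values of the continuous divergence at `ε` and at `0`, where the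
two divergences agree. The level set is closed, so its supremum belongs to it. -/
lemma clampExp_spec (hp : Measurable p) (hq : Measurable q)
    (hip : Integrable (fun x => (p x : ℝ)) μ) (hiq : Integrable (fun x => (q x : ℝ)) μ)
    (hpq : ∫ x, (p x : ℝ) ∂μ = ∫ x, (q x : ℝ) ∂μ) {ε : ℝ} (hε : 0 ≤ ε) :
    clampExp μ p q ε ∈ Icc 0 ε ∧ hockeyStick μ p q (clampExp μ p q ε) = tau μ p q ε := by
  have hc := continuous_hockeyStick hip hq
  have hτ : tau μ p q ε ∈ Icc (hockeyStick μ p q ε) (hockeyStick μ p q 0) := by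
    refine ⟨le_max_left _ _, max_le (antitone_hockeyStick hip hq hε) ?_⟩
    rw [hockeyStick_zero_comm hp hq hip hiq hpq]
    exact antitone_hockeyStick hiq hp hε
  obtain ⟨y, hy, hyτ⟩ := intermediate_value_Icc' hε hc.continuousOn hτ
  have hclosed : IsClosed {y | y ∈ Icc 0 ε ∧ hockeyStick μ p q y = tau μ p q ε} :=
    isClosed_Icc.inter (isClosed_eq hc continuous_const)
  exact hclosed.csSup_mem ⟨y, hy, hyτ⟩ ⟨ε, fun z hz => hz.1.2⟩

lemma clampExp_eq {ε : ℝ} (hε : 0 ≤ ε) (h : hockeyStick μ p q ε = tau μ p q ε) :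
    clampExp μ p q ε = ε :=
  le_antisymm (csSup_le ⟨ε, ⟨hε, le_rfl⟩, h⟩ fun _ hz => hz.1.2)
    (le_csSup ⟨ε, fun _ hz => hz.1.2⟩ ⟨⟨hε, le_rfl⟩, h⟩)

/-- Guarantees an endpoint at distance `ε` from zero, the one at which the leftover mass helps the
Chernoff bound. -/
lemma clampExp_eq_or {ε : ℝ} (hε : 0 ≤ ε) :
    clampExp μ p q ε = ε ∨ clampExp μ q p ε = ε := by
  rcases max_choice (hockeyStick μ p q ε) (hockeyStick μ q p ε) with h | h
  · exact Or.inl (clampExp_eq hε h.symm)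
  · exact Or.inr (clampExp_eq hε (by rw [tau_comm]; exact h.symm))

lemma measurable_clampedLog (hp : Measurable p) (hq : Measurable q) (a b : ℝ) :
    Measurable (clampedLog p q a b) := by
  have : Measurable fun x => ENNReal.log ((p x : ℝ≥0∞) / (q x : ℝ≥0∞)) :=
    ENNReal.measurable_log.comp (hp.coe_nnreal_ennreal.div hq.coe_nnreal_ennreal)
  exact (measurable_const.max (this.min measurable_const)).ereal_toReal

lemma hellingerSq_primeDensity (hip : Integrable (fun x => (p x : ℝ)) μ)
    (hp : Measurable p) (hq : Measurable q)
    (hiq : Integrable (fun x => (q x : ℝ)) μ) {ε : ℝ} {pt qt : X → ℝ≥0}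
    (hpt : pt = clampedDensity (clampExp μ p q ε) p q)
    (hqt : qt = clampedDensity (clampExp μ q p ε) q p)
    (h1 : ∫ x, (pt x : ℝ) ∂μ = 1 - tau μ p q ε) (h2 : ∫ x, (qt x : ℝ) ∂μ = 1 - tau μ p q ε) :
    (1 - tau μ p q ε) * hellingerSq μ (primeDensity μ p q ε) (primeDensity μ q p ε) =
      1 - tau μ p q ε - ∫ x, √(pt x : ℝ) * √(qt x : ℝ) ∂μ := by
  have hipt : Integrable (fun x => (pt x : ℝ)) μ := by
    rw [hpt]
    refine hip.mono' (measurable_clampedDensity _ hp hq).coe_nnreal_real.aestronglyMeasurable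
      (ae_of_all _ fun x => ?_)
    rw [Real.norm_of_nonneg (NNReal.coe_nonneg _), coe_clampedDensity]
    exact min_le_right _ _
  have hiqt : Integrable (fun x => (qt x : ℝ)) μ := by
    rw [hqt]
    refine hiq.mono' (measurable_clampedDensity _ hq hp).coe_nnreal_real.aestronglyMeasurable
      (ae_of_all _ fun x => ?_)
    rw [Real.norm_of_nonneg (NNReal.coe_nonneg _), coe_clampedDensity]
    exact min_le_right _ _
  have his := integrable_sqrt_mul_sqrt hipt hiqt (fun x => (pt x).coe_nonneg)
    fun x => (qt x).coe_nonneg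
  have hτ : 0 ≤ 1 - tau μ p q ε := h1 ▸ integral_nonneg fun x => (pt x).coe_nonneg
  have hp' : ∀ x, primeDensity μ p q ε x = pt x / (1 - tau μ p q ε) := fun x => by
    rw [hpt, coe_clampedDensity]; rfl
  have hq' : ∀ x, primeDensity μ q p ε x = qt x / (1 - tau μ p q ε) := fun x => by
    rw [hqt, coe_clampedDensity, tau_comm]; rfl
  rcases hτ.eq_or_lt with h0 | h0
  -- For `τ = 1` the normalized densities are junk divisions by zero, but their factor vanishes, and
  -- so does the affinity by Cauchy–Schwarz.
  · rw [← h0]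
    have hle : ∫ x, √(pt x : ℝ) * √(qt x : ℝ) ∂μ ≤ √(∫ x, (pt x : ℝ) ∂μ) * √(∫ x, (qt x : ℝ) ∂μ) :=
      integral_sqrt_mul_sqrt_le hipt hiqt (fun x => (pt x).coe_nonneg) fun x => (qt x).coe_nonneg
    have hge : 0 ≤ ∫ x, √(pt x : ℝ) * √(qt x : ℝ) ∂μ := integral_nonneg fun x => by positivity
    rw [h1, ← h0, Real.sqrt_zero, zero_mul] at hle
    linarith
  · rw [hellingerSq]
    have hpoint : ∀ x, (√(primeDensity μ p q ε x) - √(primeDensity μ q p ε x)) ^ 2 =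
        (1 - tau μ p q ε)⁻¹ * ((pt x : ℝ) + qt x - 2 * (√(pt x : ℝ) * √(qt x : ℝ))) := fun x => by
      rw [hp', hq', Real.sqrt_div (pt x).coe_nonneg, Real.sqrt_div (qt x).coe_nonneg,
        ← sub_div, div_pow, Real.sq_sqrt hτ, sub_sq, Real.sq_sqrt (pt x).coe_nonneg,
        Real.sq_sqrt (qt x).coe_nonneg]
      ring
    simp_rw [hpoint]
    have hadd : ∫ x, ((pt x : ℝ) + qt x - 2 * (√(pt x : ℝ) * √(qt x : ℝ))) ∂μ =
        2 * (1 - tau μ p q ε) - 2 * ∫ x, √(pt x : ℝ) * √(qt x : ℝ) ∂μ := by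
      rw [← integral_const_mul, two_mul (1 - tau μ p q ε)]
      nth_rewrite 1 [← h1]
      rw [← h2, ← integral_add hipt hiqt]
      exact integral_sub (hipt.add hiqt) (his.const_mul 2)
    rw [integral_const_mul, hadd]
    field_simp

/-- Clamping at the exponents `clampExp` splits off parts of equal mass `τ`. -/
theorem clampedSplit_clampExp (hp : Measurable p) (hq : Measurable q)
    [hP : IsProbabilityMeasure (μ.withDensity fun x => (p x : ℝ≥0∞))]
    [hQ : IsProbabilityMeasure (μ.withDensity fun x => (q x : ℝ≥0∞))] {ε : ℝ} (hε : 0 ≤ ε) :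
    ClampedSplit μ p q (clampedDensity (clampExp μ p q ε) p q)
      (clampedDensity (clampExp μ q p ε) q p)
      (clampedLog p q (-clampExp μ q p ε) (clampExp μ p q ε)) (-clampExp μ q p ε)
      (clampExp μ p q ε) (tau μ p q ε)
      ((1 - tau μ p q ε) * hellingerSq μ (primeDensity μ p q ε) (primeDensity μ q p ε)) := by
  have hip := integrable_coe_of_isProbabilityMeasure (μ := μ) hp
  have hiq := integrable_coe_of_isProbabilityMeasure (μ := μ) hq
  have hp1 := integral_coe_of_isProbabilityMeasure (μ := μ) hp
  have hq1 := integral_coe_of_isProbabilityMeasure (μ := μ) hq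
  obtain ⟨hb, hbτ⟩ := clampExp_spec hp hq hip hiq (hp1.trans hq1.symm) hε
  obtain ⟨ha, haτ⟩ := clampExp_spec hq hp hiq hip (hq1.trans hp1.symm) hε
  have ha0 : -clampExp μ q p ε ≤ 0 := neg_nonpos.2 ha.1
  have h1 : ∫ x, (clampedDensity (clampExp μ p q ε) p q x : ℝ) ∂μ = 1 - tau μ p q ε := by
    rw [integral_clampedDensity hip hq, hp1, hbτ]
  have h2 : ∫ x, (clampedDensity (clampExp μ q p ε) q p x : ℝ) ∂μ = 1 - tau μ p q ε := by
    rw [integral_clampedDensity hiq hp, hq1, haτ, tau_comm]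
  exact {
    measurable_p := hp
    measurable_q := hq
    measurable_pt := measurable_clampedDensity _ hp hq
    measurable_qt := measurable_clampedDensity _ hq hp
    measurable_L := measurable_clampedLog hp hq _ _
    prob_p := hP
    prob_q := hQ
    pt_le := fun x => min_le_right _ _
    qt_le := fun x => min_le_right _ _
    exp_mul := fun x => by
      simpa using exp_clampedLog_mul (p := p) (q := q) ha0 hb.1 x
    eq_b := fun x hx => clampedLog_eq_right (ha0.trans hb.1) hx
    eq_a := fun x hx => clampedLog_eq_left (by simpa using hx)
    a_le := fun x => le_clampedLog p q x
    le_b := fun x => clampedLog_le p q (ha0.trans hb.1) x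
    a_nonpos := ha0
    b_nonneg := hb.1
    integral_pt := h1
    integral_qt := h2
    affinity := by
      rw [hellingerSq_primeDensity hip hp hq hiq rfl rfl h1 h2]
      ring }

end Clamp

/-! ### Tests that are functions of the clamped log-likelihood ratio -/

/-- The output probability `φ t` of a private threshold test with threshold `κ`, as a function of
a statistic `t` of sensitivity `d`. -/
structure IsSoftThreshold (ε d κ : ℝ) (φ : ℝ → ℝ) : Prop where
  measurable : Measurable φ
  mem_Icc : ∀ t, φ t ∈ Icc (0 : ℝ) 1
  le_exp : ∀ t, φ t ≤ Real.exp (-(1 / 2 * κ)) * Real.exp (1 / 2 * t)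
  one_sub_le_exp : ∀ t, 1 - φ t ≤ Real.exp (1 / 2 * κ) * Real.exp (-(1 / 2 * t))
  priv : ∀ t t', |t - t'| ≤ d → φ t ≤ Real.exp ε * φ t' ∧ 1 - φ t ≤ Real.exp ε * (1 - φ t')
  -- When the exponential moments of order `l` are at most one, integrating these bounds leaves an
  -- error of at most `1 / 2`.
  center : κ = 0 → ∃ l c : ℝ, 0 ≤ l ∧ l ≤ 1 ∧ 0 ≤ c ∧
    ∀ t, φ t ≤ 1 / 2 + c * (Real.exp (l * t) - 1) ∧
      1 - φ t ≤ 1 / 2 + c * (Real.exp (-(l * t)) - 1)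

/-- The statistic enters the odds with factor `1 / 2`, so sensitivity `2 * ε` changes the odds by a
factor of at most `exp ε`. -/
lemma isSoftThreshold_logistic {ε d κ : ℝ} (hd : d ≤ 2 * ε) :
    IsSoftThreshold ε d κ fun t =>
      Real.exp (1 / 2 * (t - κ)) / (Real.exp (1 / 2 * (t - κ)) + 1) := by
  have hsub : ∀ t, 1 - Real.exp (1 / 2 * (t - κ)) / (Real.exp (1 / 2 * (t - κ)) + 1) =
      1 / (Real.exp (1 / 2 * (t - κ)) + 1) := fun t => by
    have := Real.exp_pos (1 / 2 * (t - κ))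
    field_simp
    ring
  refine ⟨?_, fun t => ⟨by positivity, ?_⟩, fun t => ?_, fun t => ?_, fun t t' h => ?_,
    fun h => ⟨1 / 2, 1 / 4, by norm_num, by norm_num, by norm_num, fun t => ?_⟩⟩
  · exact (Continuous.div (by fun_prop) (by fun_prop) fun t => by positivity :
      Continuous fun t : ℝ =>
        Real.exp (1 / 2 * (t - κ)) / (Real.exp (1 / 2 * (t - κ)) + 1)).measurable
  · rw [div_le_one (by positivity)]
    linarith
  · rw [← Real.exp_add, show -(1 / 2 * κ) + 1 / 2 * t = 1 / 2 * (t - κ) by ring]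
    exact div_le_self (Real.exp_nonneg _) (by linarith [Real.exp_pos (1 / 2 * (t - κ))])
  · rw [hsub, ← Real.exp_add, show 1 / 2 * κ + -(1 / 2 * t) = -(1 / 2 * (t - κ)) by ring,
      Real.exp_neg, ← one_div]
    exact one_div_le_one_div_of_le (Real.exp_pos _) (by linarith)
  · rw [hsub, hsub]
    obtain ⟨h1, h2⟩ := abs_le.1 h
    have e1 : Real.exp (1 / 2 * (t - κ)) ≤ Real.exp ε * Real.exp (1 / 2 * (t' - κ)) := by
      rw [← Real.exp_add]
      exact Real.exp_le_exp.2 (by linarith)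
    have e2 : Real.exp (1 / 2 * (t' - κ)) ≤ Real.exp ε * Real.exp (1 / 2 * (t - κ)) := by
      rw [← Real.exp_add]
      exact Real.exp_le_exp.2 (by linarith)
    have p1 := Real.exp_pos (1 / 2 * (t - κ))
    have p2 := Real.exp_pos (1 / 2 * (t' - κ))
    generalize Real.exp (1 / 2 * (t - κ)) = u at *
    generalize Real.exp (1 / 2 * (t' - κ)) = v at *
    -- The sign of `ε` is not given, but `e1` and `e2` together exclude `exp ε < 1`.
    have hE : 1 ≤ Real.exp ε := by
      by_contra hlt
      push Not at hlt
      nlinarith [Real.exp_pos ε]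
    rw [← mul_div_assoc, ← mul_div_assoc, div_le_div_iff₀ (by positivity) (by positivity),
      div_le_div_iff₀ (by positivity) (by positivity)]
    constructor
    · nlinarith [mul_pos p1 p2, mul_le_mul_of_nonneg_right hE (mul_pos p1 p2).le]
    · nlinarith
  -- The constant `1 / 4` is the slope at `u = 1` of the concave function `u / (u + 1)`, which lies
  -- below its tangent.
  · rw [hsub, h, sub_zero, Real.exp_neg]
    have p := Real.exp_pos (1 / 2 * t)
    generalize Real.exp (1 / 2 * t) = u at *
    constructor
    · rw [div_le_iff₀ (by positivity)]
      nlinarith [sq_nonneg (u - 1)]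
    · have : 1 / 2 + 1 / 4 * (u⁻¹ - 1) - 1 / (u + 1) = (u - 1) ^ 2 / (4 * u * (u + 1)) := by
        field_simp
        ring
      have h2 : 0 ≤ (u - 1) ^ 2 / (4 * u * (u + 1)) := by positivity
      linarith

/-! ### The Laplace distribution -/

/-- The upper tail of the standard Laplace distribution. -/
def laplaceTail (t : ℝ) : ℝ := if 0 ≤ t then Real.exp (-t) / 2 else 1 - Real.exp t / 2

lemma laplace_real_Ioi {s : ℝ} (hs : 0 < s) (t : ℝ) :
    (laplace s).real (Ioi t) = laplaceTail (t / s) := by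
  have hreal : (laplace s).real (Ioi t) = ∫ z in Ioi t, Real.exp (-|z| / s) / (2 * s) := by
    rw [laplace, measureReal_def, withDensity_apply _ measurableSet_Ioi,
      integral_eq_lintegral_of_nonneg_ae (ae_of_all _ fun z => by positivity)
        (by fun_prop)]
  have hIoi : ∀ u : ℝ, 0 ≤ u → IntegrableOn (fun z => Real.exp (-|z| / s) / (2 * s)) (Ioi u) ∧
      ∫ z in Ioi u, Real.exp (-|z| / s) / (2 * s) = Real.exp (-(u / s)) / 2 := fun u hu => by
    have hcongr : EqOn (fun z => Real.exp (-|z| / s) / (2 * s))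
        (fun z => (2 * s)⁻¹ * Real.exp (-s⁻¹ * z)) (Ioi u) := fun z hz => by
      simp only [abs_of_pos (hu.trans_lt hz)]
      rw [div_eq_inv_mul]
      congr 2
      ring
    have hneg : -s⁻¹ < 0 := by simpa using hs
    constructor
    · rw [integrableOn_congr_fun hcongr measurableSet_Ioi]
      exact (integrableOn_exp_mul_Ioi hneg u).const_mul _
    · rw [setIntegral_congr_fun measurableSet_Ioi hcongr, integral_const_mul,
        integral_exp_mul_Ioi hneg, show -s⁻¹ * u = -(u / s) by ring]
      field_simp
  have hIic : ∀ u : ℝ, u ≤ 0 → IntegrableOn (fun z => Real.exp (-|z| / s) / (2 * s)) (Iic u) ∧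
      ∫ z in Iic u, Real.exp (-|z| / s) / (2 * s) = Real.exp (u / s) / 2 := fun u hu => by
    have hcongr : EqOn (fun z => Real.exp (-|z| / s) / (2 * s))
        (fun z => (2 * s)⁻¹ * Real.exp (s⁻¹ * z)) (Iic u) := fun z hz => by
      simp only [abs_of_nonpos (le_trans hz hu)]
      rw [div_eq_inv_mul]
      congr 2
      ring
    have hpos : 0 < s⁻¹ := by simpa using hs
    constructor
    · rw [integrableOn_congr_fun hcongr measurableSet_Iic]
      exact (integrableOn_exp_mul_Iic hpos u).const_mul _
    · rw [setIntegral_congr_fun measurableSet_Iic hcongr, integral_const_mul,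
        integral_exp_mul_Iic hpos, show s⁻¹ * u = u / s by ring]
      field_simp
  rw [hreal, laplaceTail]
  rcases le_or_gt 0 t with ht | ht
  · rw [if_pos (div_nonneg ht hs.le), (hIoi t ht).2]
  · rw [if_neg (not_le.2 (div_neg_of_neg_of_pos ht hs))]
    have hall : Integrable (fun z => Real.exp (-|z| / s) / (2 * s)) := by
      rw [← integrableOn_univ, ← Iic_union_Ioi (a := (0 : ℝ))]
      exact (hIic 0 le_rfl).1.union (hIoi 0 le_rfl).1
    have h1 := intervalIntegral.integral_Iic_add_Ioi (b := (0 : ℝ)) hall.integrableOn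
      hall.integrableOn
    have h2 := intervalIntegral.integral_Iic_add_Ioi (b := t) hall.integrableOn
      hall.integrableOn
    rw [(hIic 0 le_rfl).2, (hIoi 0 le_rfl).2] at h1
    rw [(hIic t ht.le).2, ← h1] at h2
    simp only [zero_div, neg_zero, Real.exp_zero] at h2
    linarith

lemma laplaceTail_neg (t : ℝ) : laplaceTail (-t) = 1 - laplaceTail t := by
  unfold laplaceTail
  rcases lt_trichotomy t 0 with h | h | h
  · rw [if_pos (by linarith), if_neg (by linarith)]
    simp
  · subst h
    norm_num
  · rw [if_neg (by linarith), if_pos h.le]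

lemma laplaceTail_mem_Icc (t : ℝ) : laplaceTail t ∈ Icc (0 : ℝ) 1 := by
  unfold laplaceTail
  split_ifs with h
  · have h1 : Real.exp (-t) ≤ 1 := Real.exp_le_one_iff.2 (by linarith)
    have h2 := Real.exp_pos (-t)
    constructor <;> linarith
  · have h1 : Real.exp t ≤ 1 := Real.exp_le_one_iff.2 (by linarith)
    have h2 := Real.exp_pos t
    constructor <;> linarith

/-- For negative `t` this is `u + u⁻¹ ≥ 2` with `u = exp t`. -/
lemma laplaceTail_le_exp (t : ℝ) : laplaceTail t ≤ Real.exp (-t) / 2 := by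
  unfold laplaceTail
  split_ifs with h
  · exact le_rfl
  · have h2 := Real.exp_pos t
    rw [Real.exp_neg]
    generalize Real.exp t = u at *
    have : u⁻¹ / 2 - (1 - u / 2) = (u - 1) ^ 2 / (2 * u) := by
      field_simp
      ring
    have : 0 ≤ (u - 1) ^ 2 / (2 * u) := by positivity
    linarith

lemma laplaceTail_le_exp_mul (t : ℝ) {r : ℝ} (hr : 0 ≤ r) :
    laplaceTail t ≤ Real.exp r * laplaceTail (t + r) := by
  have hE : 1 ≤ Real.exp r := Real.one_le_exp hr
  have h0 := Real.exp_pos t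
  unfold laplaceTail
  by_cases h : 0 ≤ t
  · rw [if_pos h, if_pos (by linarith), ← mul_div_assoc, ← Real.exp_add]
    simp
  · have ht : Real.exp t ≤ 1 := Real.exp_le_one_iff.2 (by linarith)
    rw [if_neg h]
    split_ifs with h'
    · rw [← mul_div_assoc, ← Real.exp_add, show r + -(t + r) = -t by ring]
      simpa [laplaceTail, h] using laplaceTail_le_exp t
    · rw [Real.exp_add]
      have h1 : Real.exp t * Real.exp r ≤ 1 := by
        rw [← Real.exp_add]
        exact Real.exp_le_one_iff.2 (by linarith)
      nlinarith [mul_nonneg (sub_nonneg.2 hE) (sub_nonneg.2 h1),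
        mul_nonneg (sub_nonneg.2 hE) (sub_nonneg.2 ht)]

lemma antitone_laplaceTail : Antitone laplaceTail := fun t u htu => by
  unfold laplaceTail
  by_cases hu : 0 ≤ u
  · have h1 : Real.exp (-u) ≤ 1 := Real.exp_le_one_iff.2 (by linarith)
    by_cases ht : 0 ≤ t
    · rw [if_pos hu, if_pos ht]
      gcongr
    · have h2 : Real.exp t ≤ 1 := Real.exp_le_one_iff.2 (by linarith)
      rw [if_pos hu, if_neg ht]
      linarith
  · rw [if_neg hu, if_neg (by linarith)]
    gcongr

lemma laplaceTail_le_of_abs_sub_le {t u r : ℝ} (h : |t - u| ≤ r) :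
    laplaceTail t ≤ Real.exp r * laplaceTail u := by
  obtain ⟨h1, h2⟩ := abs_le.1 h
  have hr : 0 ≤ r := (abs_nonneg _).trans h
  exact (laplaceTail_le_exp_mul t hr).trans
    (mul_le_mul_of_nonneg_left (antitone_laplaceTail (by linarith)) (Real.exp_nonneg _))

/-- The tail decays at rate `1 / s`: `s ≤ 2` makes it fast enough for the Chernoff bound of order `1
/ 2`, and `1 ≤ s` keeps the order in `center` at most one. -/
lemma isSoftThreshold_laplace {ε d κ s : ℝ} (hs1 : 1 ≤ s) (hs2 : s ≤ 2) (hd : d / s ≤ ε) :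
    IsSoftThreshold ε d κ fun t => laplaceTail ((κ - t) / s) := by
  have hs : 0 < s := by linarith
  have hsub : ∀ t, 1 - laplaceTail ((κ - t) / s) = laplaceTail ((t - κ) / s) := fun t => by
    rw [← laplaceTail_neg]
    congr 1
    ring
  have hle : ∀ t, laplaceTail (t / s) ≤ Real.exp (-(1 / 2 * t)) := fun t => by
    rcases le_or_gt 0 t with ht | ht
    · calc laplaceTail (t / s) ≤ Real.exp (-(t / s)) / 2 := laplaceTail_le_exp _
        _ ≤ Real.exp (-(t / s)) := half_le_self (Real.exp_nonneg _)
        _ ≤ _ := by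
          refine Real.exp_le_exp.2 (neg_le_neg ?_)
          rw [le_div_iff₀ hs]
          nlinarith
    · exact (laplaceTail_mem_Icc _).2.trans (Real.one_le_exp (by linarith))
  have hpriv : ∀ t t', |t - t'| ≤ d →
      laplaceTail (t / s) ≤ Real.exp ε * laplaceTail (t' / s) := fun t t' h => by
    refine laplaceTail_le_of_abs_sub_le (le_trans ?_ hd)
    rw [← sub_div, abs_div, abs_of_pos hs]
    gcongr
  refine ⟨?_, fun t => laplaceTail_mem_Icc _, fun t => ?_, fun t => ?_, fun t t' h => ⟨?_, ?_⟩,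
    fun h => ⟨1 / s, 1 / 2, by positivity, ?_, by norm_num, fun t => ⟨?_, ?_⟩⟩⟩
  · exact antitone_laplaceTail.measurable.comp (by fun_prop)
  · rw [← Real.exp_add]
    refine (hle _).trans (Real.exp_le_exp.2 (by linarith))
  · rw [hsub, ← Real.exp_add]
    refine (hle _).trans (Real.exp_le_exp.2 (by linarith))
  · refine hpriv _ _ ?_
    rw [abs_sub_comm] at h
    rwa [sub_sub_sub_cancel_left]
  · rw [hsub, hsub]
    refine hpriv _ _ ?_
    rwa [sub_sub_sub_cancel_right]
  · rwa [div_le_one hs]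
  · refine (laplaceTail_le_exp _).trans (le_of_eq ?_)
    rw [h, show -((0 - t) / s) = 1 / s * t by ring]
    ring
  · rw [hsub]
    refine (laplaceTail_le_exp _).trans (le_of_eq ?_)
    rw [h, show -((t - 0) / s) = -(1 / s * t) by ring]
    ring

/-! ### Private threshold tests -/

section Tests

variable {X : Type*} [MeasurableSpace X] {μ : Measure X} {p q pt qt : X → ℝ≥0}
  {a b τ h ε κ : ℝ} {φ : ℝ → ℝ}

lemma ncLLR_eq_laplaceTail {X : Type*} (p q : X → ℝ≥0) (a b κ : ℝ) {s : ℝ} (hs : 0 < s) :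
    ncLLR p q a b s κ = fun _ x => laplaceTail ((κ - cLLR p q a b x) / s) := by
  funext n x
  rw [← laplace_real_Ioi hs, ncLLR]
  congr 1
  ext z
  simp [sub_lt_iff_lt_add']

lemma measurable_cLLR (hp : Measurable p) (hq : Measurable q) (a b : ℝ) (n : ℕ) :
    Measurable fun x : Fin n → X => cLLR p q a b x :=
  Finset.measurable_sum _ fun i _ => (measurable_clampedLog hp hq a b).comp (measurable_pi_apply i)

omit [MeasurableSpace X] in
lemma abs_cLLR_sub_le (p q : X → ℝ≥0) {a b : ℝ} (hab : a ≤ b) {n : ℕ} {x x' : Fin n → X}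
    (hx : Neighbors x x') : |cLLR p q a b x - cLLR p q a b x'| ≤ b - a := by
  obtain ⟨i, hi⟩ := hx
  have : cLLR p q a b x - cLLR p q a b x' =
      clampedLog p q a b (x i) - clampedLog p q a b (x' i) := by
    rw [cLLR, cLLR, ← Finset.sum_sub_distrib]
    refine Finset.sum_eq_single i (fun j _ hj => ?_) (by simp)
    rw [hi j hj, sub_self]
  rw [this, abs_le]
  have h1 := le_clampedLog p q (a := a) (b := b) (x i)
  have h2 := le_clampedLog p q (a := a) (b := b) (x' i)
  have h3 := clampedLog_le p q hab (x i)
  have h4 := clampedLog_le p q hab (x' i)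
  constructor <;> linarith

lemma IsSoftThreshold.isTest (hφ : IsSoftThreshold ε (b - a) κ φ) (hp : Measurable p)
    (hq : Measurable q) : IsTest fun _ x => φ (cLLR p q a b x) := fun n =>
  ⟨hφ.measurable.comp (measurable_cLLR hp hq a b n), fun _ => hφ.mem_Icc _⟩

omit [MeasurableSpace X] in
lemma IsSoftThreshold.isDP (hφ : IsSoftThreshold ε (b - a) κ φ) (p q : X → ℝ≥0) (hab : a ≤ b) :
    IsDP ε fun _ x => φ (cLLR p q a b x) := fun _ _ _ hx =>
  hφ.priv _ _ (abs_cLLR_sub_le p q hab hx)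

lemma integral_exp_cLLR (P : Measure X) [IsProbabilityMeasure P] (p q : X → ℝ≥0) (a b l : ℝ)
    (n : ℕ) :
    ∫ x, Real.exp (l * cLLR p q a b x) ∂(Measure.pi fun _ : Fin n => P) =
      (∫ x, Real.exp (l * clampedLog p q a b x) ∂P) ^ n := by
  have := integral_fintype_prod_eq_pow (ι := Fin n) (μ := P)
    fun x => Real.exp (l * clampedLog p q a b x)
  rw [Fintype.card_fin] at this
  rw [← this]
  simp_rw [cLLR, Finset.mul_sum, Real.exp_sum]

lemma integrable_exp_cLLR (P : Measure X) [IsProbabilityMeasure P] (hp : Measurable p)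
    (hq : Measurable q) (hab : a ≤ b) (l : ℝ) (n : ℕ) :
    Integrable (fun x => Real.exp (l * cLLR p q a b x)) (Measure.pi fun _ : Fin n => P) := by
  have : Integrable (fun x => Real.exp (l * clampedLog p q a b x)) P := by
    obtain ⟨C, hC⟩ := isCompact_Icc.exists_bound_of_continuousOn (s := Icc a b)
      (f := fun t => Real.exp (l * t)) (by fun_prop)
    exact Integrable.of_bound
      (((measurable_clampedLog hp hq a b).const_mul l).exp).aestronglyMeasurable C
      (ae_of_all _ fun x => hC _ ⟨le_clampedLog p q x, clampedLog_le p q hab x⟩)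
  simp_rw [cLLR, Finset.mul_sum, Real.exp_sum]
  exact Integrable.fintype_prod fun _ => this

/-! ### Chernoff bounds and advantage of threshold tests -/

variable (S : ClampedSplit μ p q pt qt (clampedLog p q a b) a b τ h)
include S

namespace ClampedSplit

lemma le_right : a ≤ b := S.a_nonpos.trans S.b_nonneg

lemma integral_exp_cLLR_Q_le {l : ℝ} (hl0 : 0 ≤ l) (hl1 : l ≤ 1) (n : ℕ) :
    ∫ x, Real.exp (l * cLLR p q a b x)
      ∂(Measure.pi fun _ : Fin n => μ.withDensity fun x => (q x : ℝ≥0∞)) ≤ 1 := by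
  have := S.prob_q
  rw [integral_exp_cLLR]
  exact pow_le_one₀ (integral_nonneg fun _ => Real.exp_nonneg _) (S.integral_exp_Q_le hl0 hl1)

lemma integral_exp_cLLR_P_le {l : ℝ} (hl0 : 0 ≤ l) (hl1 : l ≤ 1) (n : ℕ) :
    ∫ x, Real.exp (-(l * cLLR p q a b x))
      ∂(Measure.pi fun _ : Fin n => μ.withDensity fun x => (p x : ℝ≥0∞)) ≤ 1 := by
  have := S.prob_p
  simp_rw [← neg_mul]
  rw [integral_exp_cLLR]
  refine pow_le_one₀ (integral_nonneg fun _ => Real.exp_nonneg _) ?_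
  simp_rw [neg_mul]
  exact S.integral_exp_P_le hl0 hl1

lemma integral_exp_half_cLLR_Q_le (hε : 0 < ε) (ha : a = -ε) (n : ℕ) :
    ∫ x, Real.exp (1 / 2 * cLLR p q a b x)
      ∂(Measure.pi fun _ : Fin n => μ.withDensity fun x => (q x : ℝ≥0∞)) ≤
      Real.exp (-(n * (min ε 1 * τ + h)) / 3) := by
  have := S.prob_q
  rw [integral_exp_cLLR, show -(n * (min ε 1 * τ + h)) / 3 = n * (-((min ε 1 * τ + h) / 3)) by
    ring, Real.exp_nat_mul]
  exact pow_le_pow_left₀ (integral_nonneg fun _ => Real.exp_nonneg _)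
    (S.integral_exp_half_Q_le hε ha) n

lemma integral_exp_half_cLLR_P_le (hε : 0 < ε) (hb : b = ε) (n : ℕ) :
    ∫ x, Real.exp (-(1 / 2 * cLLR p q a b x))
      ∂(Measure.pi fun _ : Fin n => μ.withDensity fun x => (p x : ℝ≥0∞)) ≤
      Real.exp (-(n * (min ε 1 * τ + h)) / 3) := by
  have := S.prob_p
  simp_rw [← neg_mul]
  rw [integral_exp_cLLR, show -n * (min ε 1 * τ + h) / 3 = n * (-((min ε 1 * τ + h) / 3)) by
    ring, Real.exp_nat_mul]
  refine pow_le_pow_left₀ (integral_nonneg fun _ => Real.exp_nonneg _) ?_ n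
  simp_rw [neg_mul]
  exact S.integral_exp_half_P_le hε hb

lemma integral_threshold_Q_le (hφ : IsSoftThreshold ε (b - a) κ φ) (n : ℕ) :
    ∫ x, φ (cLLR p q a b x) ∂(Measure.pi fun _ : Fin n => μ.withDensity fun x => (q x : ℝ≥0∞)) ≤
      Real.exp (-(1 / 2 * κ)) * ∫ x, Real.exp (1 / 2 * cLLR p q a b x)
        ∂(Measure.pi fun _ : Fin n => μ.withDensity fun x => (q x : ℝ≥0∞)) := by
  have := S.prob_q
  have hT := hφ.isTest S.measurable_p S.measurable_q n
  rw [← integral_const_mul]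
  exact integral_mono (integrable_of_mem_Icc hT.1 hT.2)
    ((integrable_exp_cLLR _ S.measurable_p S.measurable_q S.le_right _ n).const_mul _)
    fun x => hφ.le_exp _

lemma integral_one_sub_threshold_P_le (hφ : IsSoftThreshold ε (b - a) κ φ) (n : ℕ) :
    1 - ∫ x, φ (cLLR p q a b x)
        ∂(Measure.pi fun _ : Fin n => μ.withDensity fun x => (p x : ℝ≥0∞)) ≤
      Real.exp (1 / 2 * κ) * ∫ x, Real.exp (-(1 / 2 * cLLR p q a b x))
        ∂(Measure.pi fun _ : Fin n => μ.withDensity fun x => (p x : ℝ≥0∞)) := by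
  have := S.prob_p
  have hT := hφ.isTest S.measurable_p S.measurable_q n
  have hi := integrable_of_mem_Icc
    (ν := Measure.pi fun _ : Fin n => μ.withDensity fun x => (p x : ℝ≥0∞)) hT.1 hT.2
  have he := integrable_exp_cLLR (μ.withDensity fun x => (p x : ℝ≥0∞)) S.measurable_p
    S.measurable_q S.le_right (-(1 / 2)) n
  simp_rw [neg_mul] at he
  rw [← integral_const_mul]
  calc _ = ∫ x, (1 - φ (cLLR p q a b x))
        ∂(Measure.pi fun _ : Fin n => μ.withDensity fun x => (p x : ℝ≥0∞)) := by
        rw [integral_sub (integrable_const _) hi]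
        simp
    _ ≤ _ := integral_mono ((integrable_const _).sub hi) (he.const_mul _)
        fun x => hφ.one_sub_le_exp _

lemma integral_threshold_Q_le_half (hφ : IsSoftThreshold ε (b - a) 0 φ) (n : ℕ) :
    ∫ x, φ (cLLR p q a b x) ∂(Measure.pi fun _ : Fin n => μ.withDensity fun x => (q x : ℝ≥0∞)) ≤
      1 / 2 := by
  have := S.prob_q
  have hT := hφ.isTest S.measurable_p S.measurable_q n
  obtain ⟨l, c, hl0, hl1, hc, hb⟩ := hφ.center rfl
  have he := integrable_exp_cLLR (μ.withDensity fun x => (q x : ℝ≥0∞)) S.measurable_p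
    S.measurable_q S.le_right l n
  have hm := S.integral_exp_cLLR_Q_le hl0 hl1 n
  have hi : Integrable (fun x => c * (Real.exp (l * cLLR p q a b x) - 1))
      (Measure.pi fun _ : Fin n => μ.withDensity fun x => (q x : ℝ≥0∞)) :=
    (he.sub (integrable_const _)).const_mul c
  calc _ ≤ ∫ x, (1 / 2 + c * (Real.exp (l * cLLR p q a b x) - 1))
        ∂(Measure.pi fun _ : Fin n => μ.withDensity fun x => (q x : ℝ≥0∞)) :=
        integral_mono (integrable_of_mem_Icc hT.1 hT.2) ((integrable_const _).add hi)
          fun x => (hb _).1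
    _ ≤ _ := by
        rw [integral_add (integrable_const _) hi, integral_const_mul,
          integral_sub he (integrable_const _)]
        simp only [integral_const, probReal_univ, smul_eq_mul, one_mul]
        nlinarith

lemma integral_threshold_P_ge_half (hφ : IsSoftThreshold ε (b - a) 0 φ) (n : ℕ) :
    1 / 2 ≤ ∫ x, φ (cLLR p q a b x)
      ∂(Measure.pi fun _ : Fin n => μ.withDensity fun x => (p x : ℝ≥0∞)) := by
  have := S.prob_p
  have hT := hφ.isTest S.measurable_p S.measurable_q n
  obtain ⟨l, c, hl0, hl1, hc, hb⟩ := hφ.center rfl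
  have he := integrable_exp_cLLR (μ.withDensity fun x => (p x : ℝ≥0∞)) S.measurable_p
    S.measurable_q S.le_right (-l) n
  simp_rw [neg_mul] at he
  have hm := S.integral_exp_cLLR_P_le hl0 hl1 n
  have hi : Integrable (fun x => c * (Real.exp (-(l * cLLR p q a b x)) - 1))
      (Measure.pi fun _ : Fin n => μ.withDensity fun x => (p x : ℝ≥0∞)) :=
    (he.sub (integrable_const _)).const_mul c
  calc (1 / 2 : ℝ) ≤ ∫ x, (1 / 2 - c * (Real.exp (-(l * cLLR p q a b x)) - 1))
        ∂(Measure.pi fun _ : Fin n => μ.withDensity fun x => (p x : ℝ≥0∞)) := by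
        rw [integral_sub (integrable_const _) hi, integral_const_mul,
          integral_sub he (integrable_const _)]
        simp only [integral_const, probReal_univ, smul_eq_mul, one_mul]
        nlinarith
    _ ≤ _ := integral_mono ((integrable_const _).sub hi) (integrable_of_mem_Icc hT.1 hT.2)
          fun x => by linarith [(hb (cLLR p q a b x)).2]

/-- With threshold zero the advantage tends to at least one half. -/
theorem half_sub_le_adv (hε : 0 < ε) (hab : b = ε ∨ a = -ε)
    (hφ : IsSoftThreshold ε (b - a) 0 φ) (n : ℕ) :
    1 / 2 - Real.exp (-(n * (min ε 1 * τ + h)) / 3) ≤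
      adv (μ.withDensity fun x => (p x : ℝ≥0∞)) (μ.withDensity fun x => (q x : ℝ≥0∞))
        (fun _ x => φ (cLLR p q a b x)) n := by
  rw [adv]
  rcases hab with hb | ha
  · have h1 := S.integral_threshold_Q_le_half hφ n
    have h2 := S.integral_one_sub_threshold_P_le hφ n
    have h3 := S.integral_exp_half_cLLR_P_le hε hb n
    rw [mul_zero, Real.exp_zero, one_mul] at h2
    linarith
  · have h1 := S.integral_threshold_P_ge_half hφ n
    have h2 := S.integral_threshold_Q_le hφ n
    have h3 := S.integral_exp_half_cLLR_Q_le hε ha n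
    rw [mul_zero, neg_zero, Real.exp_zero, one_mul] at h2
    linarith

/-- With the threshold `k` if `b = ε`, or `-k` if `a = -ε`, the advantage tends to at least
`1 - exp (-k / 2)`. -/
theorem one_sub_le_adv (hε : 0 < ε) {k : ℝ} (hab : b = ε ∧ κ = k ∨ a = -ε ∧ κ = -k)
    (hφ : IsSoftThreshold ε (b - a) κ φ) (n : ℕ) :
    1 - Real.exp (-(1 / 2 * k)) -
        Real.exp (1 / 2 * k) * Real.exp (-(n * (min ε 1 * τ + h)) / 3) ≤
      adv (μ.withDensity fun x => (p x : ℝ≥0∞)) (μ.withDensity fun x => (q x : ℝ≥0∞))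
        (fun _ x => φ (cLLR p q a b x)) n := by
  have h1 := S.integral_one_sub_threshold_P_le hφ n
  have h2 := S.integral_threshold_Q_le hφ n
  rw [adv]
  -- The threshold is moved against the error without decay, which drops to `exp (-k / 2)`; the
  -- other error grows by `exp (k / 2)`, a factor that its decay absorbs.
  rcases hab with ⟨hb, rfl⟩ | ⟨ha, rfl⟩
  · have h3 := mul_le_mul_of_nonneg_left (S.integral_exp_half_cLLR_P_le hε hb n)
      (Real.exp_nonneg (1 / 2 * κ))
    have h4 := mul_le_mul_of_nonneg_left
      (S.integral_exp_cLLR_Q_le (l := 1 / 2) (by norm_num) (by norm_num) n)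
      (Real.exp_nonneg (-(1 / 2 * κ)))
    linarith
  · have h3 := mul_le_mul_of_nonneg_left (S.integral_exp_half_cLLR_Q_le hε ha n)
      (Real.exp_nonneg (1 / 2 * k))
    have h4 := mul_le_mul_of_nonneg_left
      (S.integral_exp_cLLR_P_le (l := 1 / 2) (by norm_num) (by norm_num) n)
      (Real.exp_nonneg (-(1 / 2 * k)))
    rw [mul_neg] at h1 h2
    rw [neg_neg] at h2
    linarith

end ClampedSplit

omit S in
-- Privacy gives a difference of at most `(1 - exp (-ε)) * K n x`, hence at most `ε`.
lemma IsDP.sub_le_min {K : RandTest X} (hK : IsTest K) (hD : IsDP ε K) (hε : 0 ≤ ε) {n : ℕ}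
    {x y : Fin n → X} (hxy : Neighbors x y) : K n x - K n y ≤ min ε 1 := by
  have h1 := (hK n).2 x
  have h2 := (hK n).2 y
  refine le_min ?_ (by linarith [h1.2, h2.1])
  have h3 := (hD n x y hxy).1
  have h4 : Real.exp (-ε) * K n x ≤ K n y := by
    rwa [Real.exp_neg, inv_mul_le_iff₀ (Real.exp_pos ε)]
  have h5 := Real.add_one_le_exp (-ε)
  nlinarith [h1.1, h1.2]

/-- The advantage of a private test on `n` samples is small until `n` times the rate is of order
one. -/
theorem ClampedSplit.adv_le_of_isDP (hε : 0 ≤ ε) {K : RandTest X} (hK : IsTest K)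
    (hD : IsDP ε K) (n : ℕ) :
    adv (μ.withDensity fun x => (p x : ℝ≥0∞)) (μ.withDensity fun x => (q x : ℝ≥0∞)) K n ≤
      n * (min ε 1 * τ + h) + √(2 * (n * (min ε 1 * τ + h))) := by
  have hm : 0 ≤ min ε 1 := le_min hε zero_le_one
  refine (S.adv_le_of_bounded_differences (hK n).1 (hK n).2 fun x y hxy =>
    hD.sub_le_min hK hε hxy).trans ?_
  have h1 := mul_nonneg hm S.tau_nonneg
  have h2 := S.h_nonneg
  rw [mul_assoc 2]
  gcongr <;> linarith

/-- The advantage of the soft test with offset zero on one sample is of the order of the rate. -/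
theorem ClampedSplit.adv_scLLR_mem_Icc (hε : 0 < ε) (ha : -ε ≤ a) (hb : b ≤ ε)
    (hab : b = ε ∨ a = -ε) :
    adv (μ.withDensity fun x => (p x : ℝ≥0∞)) (μ.withDensity fun x => (q x : ℝ≥0∞))
        (scLLR p q a b 0) 1 ∈
      Icc ((min ε 1 * τ + h) / 10) (min ε 1 * τ + h) := by
  have := S.prob_p
  have := S.prob_q
  have hadv : adv (μ.withDensity fun x => (p x : ℝ≥0∞))
      (μ.withDensity fun x => (q x : ℝ≥0∞)) (scLLR p q a b 0) 1 =
      h + τ * (Real.exp (1 / 2 * b) / (Real.exp (1 / 2 * b) + 1) -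
        Real.exp (1 / 2 * a) / (Real.exp (1 / 2 * a) + 1)) := by
    have hm : Measurable fun x => Real.exp (1 / 2 * clampedLog p q a b x) /
        (Real.exp (1 / 2 * clampedLog p q a b x) + 1) := by
      have := ((measurable_clampedLog S.measurable_p S.measurable_q a b).const_mul (1 / 2)).exp
      exact this.div (this.add_const 1)
    rw [← S.integral_soft_sub, adv]
    simp only [scLLR, cLLR, Fin.sum_univ_one, sub_zero]
    rw [integral_comp_eval (μ := fun _ : Fin 1 => μ.withDensity fun x => (p x : ℝ≥0∞)) (i := 0)
        hm.aestronglyMeasurable,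
      integral_comp_eval (μ := fun _ : Fin 1 => μ.withDensity fun x => (q x : ℝ≥0∞)) (i := 0)
        hm.aestronglyMeasurable]
  have hσ : ∀ t : ℝ, Real.exp (1 / 2 * -t) / (Real.exp (1 / 2 * -t) + 1) =
      1 - Real.exp (1 / 2 * t) / (Real.exp (1 / 2 * t) + 1) := fun t => by
    have := Real.exp_pos (1 / 2 * t)
    rw [mul_neg, Real.exp_neg]
    field_simp
    ring
  have hmono : ∀ t u : ℝ, t ≤ u → Real.exp (1 / 2 * t) / (Real.exp (1 / 2 * t) + 1) ≤
      Real.exp (1 / 2 * u) / (Real.exp (1 / 2 * u) + 1) := fun t u htu => by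
    have : Real.exp (1 / 2 * t) ≤ Real.exp (1 / 2 * u) := Real.exp_le_exp.2 (by linarith)
    rw [div_le_div_iff₀ (by positivity) (by positivity)]
    linarith
  have hzero : Real.exp (1 / 2 * (0 : ℝ)) / (Real.exp (1 / 2 * (0 : ℝ)) + 1) = 1 / 2 := by
    norm_num
  have hm0 : 0 < min ε 1 := lt_min hε one_pos
  have hm1 : min ε 1 ≤ 1 := min_le_right _ _
  -- With `u ≥ 1 + m / 2` and `m = min ε 1 ≤ 1`, the excess `(u - 1) / (2 * (u + 1))` is at least `m
  -- / (8 + 2 * m) ≥ m / 10`.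
  have hlow : 1 / 2 + min ε 1 / 10 ≤ Real.exp (1 / 2 * ε) / (Real.exp (1 / 2 * ε) + 1) := by
    have h1 : 1 + min ε 1 / 2 ≤ Real.exp (1 / 2 * ε) := by
      linarith [Real.add_one_le_exp (1 / 2 * ε), min_le_left ε 1]
    rw [le_div_iff₀ (by positivity)]
    nlinarith
  have hup : Real.exp (1 / 2 * ε) / (Real.exp (1 / 2 * ε) + 1) ≤ 1 / 2 + min ε 1 / 2 := by
    have hpos := Real.exp_pos (1 / 2 * ε)
    rcases min_cases ε 1 with ⟨h1, h2⟩ | ⟨h1, h2⟩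
    · rw [h1]
      have h3 : (1 - ε / 2) * Real.exp (1 / 2 * ε) ≤ 1 := by
        have h4 := Real.add_one_le_exp (-(1 / 2 * ε))
        calc _ ≤ Real.exp (-(1 / 2 * ε)) * Real.exp (1 / 2 * ε) := by
              gcongr
              linarith
          _ = 1 := by rw [← Real.exp_add]; simp
      rw [div_le_iff₀ (by positivity)]
      nlinarith
    · rw [h1, div_le_iff₀ (by positivity)]
      linarith
  have b0 := hmono 0 b S.b_nonneg
  have a0 := hmono a 0 S.a_nonpos
  have b1 := hmono b ε hb
  have a1 := hmono (-ε) a ha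
  rw [hσ ε] at a1
  rw [hzero] at a0 b0
  have hD : min ε 1 / 10 ≤ Real.exp (1 / 2 * b) / (Real.exp (1 / 2 * b) + 1) -
        Real.exp (1 / 2 * a) / (Real.exp (1 / 2 * a) + 1) := by
    rcases hab with rfl | rfl
    · linarith
    · rw [hσ ε] at a0 ⊢
      linarith
  rw [hadv]
  have hτ := S.tau_nonneg
  have h0 := S.h_nonneg
  constructor
  · nlinarith
  · nlinarith

end Tests

/-! ### Sample complexities -/

section SampleComplexity

variable {X : Type*} [MeasurableSpace X] {P Q : Measure X} {γ R : ℝ}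

/-- If `N * R < γ ^ 2 / 8`, the square root is at most `γ / 2` and the linear term is below `γ / 8`,
too little for advantage `γ`. For `R = 0` no `N` qualifies. -/
lemma le_SC {K : RandTest X} (hγ0 : 0 < γ) (hγ1 : γ < 1) (hR : 0 ≤ R)
    (hK : ∀ n : ℕ, adv P Q K n ≤ n * R + √(2 * (n * R))) :
    ((γ ^ 2 / 8).toNNReal : ℝ≥0∞) * (ENNReal.ofReal R)⁻¹ ≤ SC γ P Q K := by
  refine le_iInf₂ fun N hN => ?_
  have h1 : γ ≤ N * R + √(2 * (N * R)) := (hN N le_rfl).trans (hK N)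
  have hNR : 0 ≤ N * R := mul_nonneg N.cast_nonneg hR
  have h2 : γ ^ 2 / 8 ≤ N * R := by
    by_contra! hlt
    have : √(2 * (N * R)) ≤ γ / 2 := by
      rw [Real.sqrt_le_left (by positivity)]
      linarith
    nlinarith
  have hR0 : 0 < R := by
    rcases hR.eq_or_lt with h | h
    · rw [← h, mul_zero] at h2
      nlinarith [pow_pos hγ0 2]
    · exact h
  rw [← ENNReal.ofReal_inv_of_pos hR0, ← ENNReal.ofReal.eq_1, ← ENNReal.ofReal_mul (by positivity),
    ← ENNReal.ofReal_natCast]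
  refine ENNReal.ofReal_le_ofReal ?_
  rwa [← div_eq_mul_inv, div_le_iff₀ hR0]

/-- Rounding up costs at most one sample, and `1 ≤ 1 / R`. -/
lemma SC_le {K : RandTest X} {M : ℝ} (hM : 0 ≤ M) (hR : 0 ≤ R) (hR1 : R ≤ 1)
    (hK : ∀ n : ℕ, M ≤ n * R → γ ≤ adv P Q K n) :
    SC γ P Q K ≤ ((M + 1).toNNReal : ℝ≥0∞) * (ENNReal.ofReal R)⁻¹ := by
  rcases hR.eq_or_lt with h | h
  · rw [← h, ENNReal.ofReal_zero, ENNReal.inv_zero, ENNReal.mul_top]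
    · exact le_top
    · simp only [ne_eq, ENNReal.coe_eq_zero, Real.toNNReal_eq_zero, not_le]
      linarith
  · refine (iInf₂_le ⌈M / R⌉₊ fun n hn => hK n ?_).trans ?_
    · rw [← div_le_iff₀ h]
      exact (Nat.le_ceil _).trans (by exact_mod_cast hn)
    · rw [← ENNReal.ofReal_inv_of_pos h, ← ENNReal.ofReal.eq_1,
        ← ENNReal.ofReal_mul (by positivity), ← ENNReal.ofReal_natCast]
      refine ENNReal.ofReal_le_ofReal ((Nat.ceil_lt_add_one (by positivity)).le.trans ?_)
      rw [← div_eq_mul_inv, add_div]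
      gcongr
      rwa [one_le_div h]

lemma within_inv_of_mem_Icc {A : ℝ} (hA : A ∈ Icc (R / 10) R) {c C : ℝ≥0}
    (hc : c ≤ 1) (hC : 10 ≤ C) :
    Within c C (ENNReal.ofReal A)⁻¹ (ENNReal.ofReal R)⁻¹ := by
  constructor
  · calc (c : ℝ≥0∞) * (ENNReal.ofReal R)⁻¹ ≤ 1 * (ENNReal.ofReal R)⁻¹ := by
          gcongr
          exact_mod_cast hc
      _ = (ENNReal.ofReal R)⁻¹ := one_mul _
      _ ≤ _ := ENNReal.inv_le_inv.2 (ENNReal.ofReal_le_ofReal hA.2)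
  · calc (ENNReal.ofReal A)⁻¹ ≤ (ENNReal.ofReal (R / 10))⁻¹ :=
          ENNReal.inv_le_inv.2 (ENNReal.ofReal_le_ofReal hA.1)
      _ = 10 * (ENNReal.ofReal R)⁻¹ := by
          rw [ENNReal.ofReal_div_of_pos (by norm_num), ENNReal.inv_div (by simp) (by simp),
            div_eq_mul_inv]
          simp
      _ ≤ _ := by
          gcongr
          exact_mod_cast hC

/-- The threshold and the number of samples for a given advantage. -/
lemma exists_threshold (hγ1 : γ < 1) :
    ∃ k M : ℝ, 0 ≤ M ∧
      ((γ < 1 / 2 ∧ k = 0 ∧ γ ≤ 1 / 2 - Real.exp (-M / 3)) ∨ (¬ γ < 1 / 2 ∧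
        γ ≤ 1 - Real.exp (-(1 / 2 * k)) - Real.exp (1 / 2 * k) * Real.exp (-M / 3))) := by
  have key : ∀ δ : ℝ, 0 < δ → ∃ M : ℝ, 0 ≤ M ∧ Real.exp (-M / 3) ≤ δ := fun δ hδ => by
    refine ⟨max 0 (-(3 * Real.log δ)), le_max_left _ _, ?_⟩
    rw [← Real.le_log_iff_exp_le hδ]
    linarith [le_max_right 0 (-(3 * Real.log δ))]
  by_cases hγ : γ < 1 / 2
  · obtain ⟨M, hM, h⟩ := key (1 / 2 - γ) (by linarith)
    exact ⟨0, M, hM, Or.inl ⟨hγ, rfl, by linarith⟩⟩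
  · have hη : 0 < (1 - γ) / 2 := by linarith
    obtain ⟨M, hM, h⟩ := key (((1 - γ) / 2) ^ 2) (by positivity)
    -- This `k` makes `exp (-k / 2) = (1 - γ) / 2`, half of the allowed loss; `M` brings the other
    -- error below the second half.
    refine ⟨-(2 * Real.log ((1 - γ) / 2)), M, hM, Or.inr ⟨hγ, ?_⟩⟩
    have e1 : Real.exp (-(1 / 2 * -(2 * Real.log ((1 - γ) / 2)))) = (1 - γ) / 2 := by
      rw [show -(1 / 2 * -(2 * Real.log ((1 - γ) / 2))) = Real.log ((1 - γ) / 2) by ring,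
        Real.exp_log hη]
    have e2 : Real.exp (1 / 2 * -(2 * Real.log ((1 - γ) / 2))) = ((1 - γ) / 2)⁻¹ := by
      rw [show 1 / 2 * -(2 * Real.log ((1 - γ) / 2)) = -Real.log ((1 - γ) / 2) by ring,
        Real.exp_neg, Real.exp_log hη]
    rw [e1, e2]
    have : ((1 - γ) / 2)⁻¹ * Real.exp (-M / 3) ≤ (1 - γ) / 2 := by
      rw [inv_mul_le_iff₀ hη]
      linarith
    linarith

end SampleComplexity

end PrivTest

end

/-! ### The main theorem -/

theorem theorem1 (γ : ℝ) (hγ0 : 0 < γ) (hγ1 : γ < 1) :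
    ∃ c C : ℝ≥0, 0 < c ∧ 0 < C ∧
      ∀ (X : Type*) [MeasurableSpace X] (μ P Q : Measure X)
        [IsProbabilityMeasure P] [IsProbabilityMeasure Q]
        (p q : X → ℝ≥0) (_ : Measurable p) (_ : Measurable q)
        (_ : P = μ.withDensity fun x => (p x : ℝ≥0∞))
        (_ : Q = μ.withDensity fun x => (q x : ℝ≥0∞))
        (ε : ℝ) (_ : 0 < ε) (a b : ℝ)
        (_ : a = -PrivTest.clampExp μ q p ε) (_ : b = PrivTest.clampExp μ p q ε),
        -- the optimal private sample complexity
        PrivTest.Within c C (PrivTest.privSC γ ε P Q)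
          (ENNReal.ofReal (PrivTest.rate μ p q ε))⁻¹ ∧
        -- the advantage of the soft test on one sample
        PrivTest.Within c C (ENNReal.ofReal (PrivTest.adv P Q (PrivTest.scLLR p q a b 0) 1))⁻¹
          (ENNReal.ofReal (PrivTest.rate μ p q ε))⁻¹ ∧
        ∃ κ : ℝ, (γ < 1 / 2 → κ = 0) ∧
          -- the soft test is private and optimal
          (PrivTest.IsTest (PrivTest.scLLR p q a b κ) ∧
            PrivTest.IsDP ε (PrivTest.scLLR p q a b κ) ∧
            PrivTest.Within c C (PrivTest.SC γ P Q (PrivTest.scLLR p q a b κ))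
              (ENNReal.ofReal (PrivTest.rate μ p q ε))⁻¹) ∧
          -- the noisy test is private and optimal
          ∀ s : ℝ, (b - a) / ε ≤ s → s ≤ 2 →
            PrivTest.IsTest (PrivTest.ncLLR p q a b s κ) ∧
            PrivTest.IsDP ε (PrivTest.ncLLR p q a b s κ) ∧
            PrivTest.Within c C (PrivTest.SC γ P Q (PrivTest.ncLLR p q a b s κ))
              (ENNReal.ofReal (PrivTest.rate μ p q ε))⁻¹ := by
  obtain ⟨k, M, hM, hkM⟩ := PrivTest.exists_threshold hγ1
  -- `M + 1` serves the sample complexities, and `10` the advantage on one sample.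
  refine ⟨(γ ^ 2 / 8).toNNReal, (M + 1).toNNReal + 10, by simpa using by positivity,
    by positivity, ?_⟩
  intro X _ μ P Q _ _ p q hp hq hP hQ ε hε a b ha hb
  subst hP hQ
  set R := PrivTest.rate μ p q ε with hRdef
  have hip := PrivTest.integrable_coe_of_isProbabilityMeasure (μ := μ) hp
  have hiq := PrivTest.integrable_coe_of_isProbabilityMeasure (μ := μ) hq
  have hpq := (PrivTest.integral_coe_of_isProbabilityMeasure (μ := μ) hp).trans
    (PrivTest.integral_coe_of_isProbabilityMeasure (μ := μ) hq).symm
  have hbε := (PrivTest.clampExp_spec hp hq hip hiq hpq hε.le).1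
  have haε := (PrivTest.clampExp_spec hq hp hiq hip hpq.symm hε.le).1
  have S := PrivTest.clampedSplit_clampExp (μ := μ) hp hq hε.le
  have hab := PrivTest.clampExp_eq_or (μ := μ) (p := p) (q := q) hε.le
  rw [← hb] at hbε hab
  rw [← ha, ← hb] at S
  have haε' : -ε ≤ a := by linarith [haε.2]
  have hab' : b = ε ∨ a = -ε := hab.imp id fun h => by rw [ha, h]
  have hbaε : ε ≤ b - a := by
    have := S.a_nonpos
    rcases hab' with h | h <;> linarith [hbε.1]
  have hm0 : 0 ≤ min ε 1 := le_min hε.le zero_le_one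
  have hR0 : 0 ≤ R := add_nonneg (mul_nonneg hm0 S.tau_nonneg) S.h_nonneg
  have hR1 : R ≤ 1 := by
    have h1 := S.h_le
    have h2 := mul_le_of_le_one_left S.tau_nonneg (min_le_right ε 1)
    rw [hRdef, PrivTest.rate]
    linarith
  have hlower : ∀ K : PrivTest.RandTest X, PrivTest.IsTest K → PrivTest.IsDP ε K →
      ((γ ^ 2 / 8).toNNReal : ENNReal) * (ENNReal.ofReal R)⁻¹ ≤
        PrivTest.SC γ (μ.withDensity fun x => (p x : ENNReal))
          (μ.withDensity fun x => (q x : ENNReal)) K := fun K hK hD =>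
    PrivTest.le_SC hγ0 hγ1 hR0 (S.adv_le_of_isDP hε.le hK hD)
  -- For `γ ≥ 1 / 2` the sign of the threshold depends on which endpoint is at distance `ε`.
  obtain ⟨κ, hκ0, hκ⟩ : ∃ κ : ℝ, (γ < 1 / 2 → κ = 0) ∧
      (γ < 1 / 2 ∨ (b = ε ∧ κ = k ∨ a = -ε ∧ κ = -k)) := by
    by_cases hγ : γ < 1 / 2
    · exact ⟨0, fun _ => rfl, Or.inl hγ⟩
    · rcases hab' with h | h
      · exact ⟨k, fun h' => absurd h' hγ, Or.inr (Or.inl ⟨h, rfl⟩)⟩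
      · exact ⟨-k, fun h' => absurd h' hγ, Or.inr (Or.inr ⟨h, rfl⟩)⟩
  have hthreshold : ∀ φ : ℝ → ℝ, PrivTest.IsSoftThreshold ε (b - a) κ φ →
      PrivTest.IsTest (fun _ x => φ (PrivTest.cLLR p q a b x) : PrivTest.RandTest X) ∧
      PrivTest.IsDP ε (fun _ x => φ (PrivTest.cLLR p q a b x) : PrivTest.RandTest X) ∧
      PrivTest.Within (γ ^ 2 / 8).toNNReal ((M + 1).toNNReal + 10)
        (PrivTest.SC γ (μ.withDensity fun x => (p x : ENNReal))
          (μ.withDensity fun x => (q x : ENNReal)) fun _ x => φ (PrivTest.cLLR p q a b x))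
        (ENNReal.ofReal R)⁻¹ := fun φ hφ => by
    have hT : PrivTest.IsTest (fun _ x => φ (PrivTest.cLLR p q a b x) : PrivTest.RandTest X) :=
      hφ.isTest hp hq
    have hD := hφ.isDP p q S.le_right
    refine ⟨hT, hD, hlower _ hT hD, ?_⟩
    refine (PrivTest.SC_le hM hR0 hR1 fun n hn => ?_).trans
      (by gcongr; exact le_self_add)
    have hexp : Real.exp (-(n * R) / 3) ≤ Real.exp (-M / 3) :=
      Real.exp_le_exp.2 (by linarith)
    rcases hkM with ⟨hγ, -, hMγ⟩ | ⟨hγ, hMγ⟩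
    · have hκ' := hκ0 hγ
      subst hκ'
      have := S.half_sub_le_adv hε hab' hφ n
      exact (by linarith : γ ≤ 1 / 2 - Real.exp (-(n * R) / 3)).trans this
    · have := S.one_sub_le_adv hε (hκ.resolve_left hγ) hφ n
      refine le_trans ?_ this
      have := mul_le_mul_of_nonneg_left hexp (Real.exp_nonneg (1 / 2 * k))
      exact (by linarith : γ ≤ 1 - Real.exp (-(1 / 2 * k)) -
        Real.exp (1 / 2 * k) * Real.exp (-(n * R) / 3))
  have hsoft := hthreshold _ (PrivTest.isSoftThreshold_logistic (κ := κ)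
    (by linarith [hbε.2] : b - a ≤ 2 * ε))
  refine ⟨⟨le_iInf fun K => le_iInf fun hK => le_iInf fun hD => hlower K hK hD, ?_⟩, ?_,
    κ, hκ0, hsoft, fun s hs1 hs2 => ?_⟩
  · rw [PrivTest.privSC]
    exact iInf_le_of_le _ (iInf_le_of_le hsoft.1 (iInf_le_of_le hsoft.2.1 hsoft.2.2.2))
  · refine PrivTest.within_inv_of_mem_Icc (S.adv_scLLR_mem_Icc hε haε' hbε.2 hab') ?_ ?_
    · rw [Real.toNNReal_le_one]
      nlinarith
    · exact le_add_self
  -- An endpoint at distance `ε` gives `b - a ≥ ε`, so admissible scales are at least one.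
  · have hs : 1 ≤ s := le_trans (by rwa [one_le_div hε]) hs1
    rw [PrivTest.ncLLR_eq_laplaceTail p q a b κ (by linarith)]
    refine hthreshold (fun t => PrivTest.laplaceTail ((κ - t) / s))
      (PrivTest.isSoftThreshold_laplace hs hs2 ?_)
    rw [div_le_iff₀ hε] at hs1
    rw [div_le_iff₀ (by linarith)]
    linarith
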